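/- Let $n,p\ge 1$, $\alpha,\sigma>0$, let $\Upsilon=(\gamma_{ij})\in\mathbb R^{n\times p}$ and $\tilde\gamma\in\mathbb R^p$ be deterministic, and put $\widetilde S_p=\mathrm{diag}(\tilde\gamma_1^2,\dots,\tilde\gamma_p^2)$. Let $X_n=\Upsilon\circ Z_n$ (entrywise product), where the entries of $Z_n$ are iid, centred, with variance $1$, and let $\tilde x=\widetilde S_p^{1/2}\tilde z$, where the entries of $\tilde z$ are iid, centred, with variance $1$; all these entries have a finite moment of some order $4+\delta$, $\delta>0$. Let $Y_n=X_n\beta_\ast+\varepsilon_n$ and $\tilde y=\tilde x^\top\beta_\ast+\tilde\varepsilon$, where $\mathbb E[\beta_\ast]=0$, $\mathbb E[\beta_\ast\beta_\ast^\top]=\frac{\alpha^2}{p}I_p$, $\mathbb E[\varepsilon_n]=0$, $\mathbb E[\varepsilon_n\varepsilon_n^\top]=\sigma^2I_n$, $\mathbb E[\tilde\varepsilon]=0$, $\mathbb E[\tilde\varepsilon^2]=\sigma^2$, and $X_n,\varepsilon_n,\beta_\ast,\tilde x,\tilde\varepsilon$ are independent. For $\lambda>0$ let $$\hat\theta_\lambda=(X_n^\top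 X_n+n\lambda I_p)^{-1}X_n^\top Y_n,\qquad \hat r^{test}_\lambda(X_n)=\mathbb E\big[(\tilde y-\tilde x^\top\hat\theta_\lambda)^2\,\big|\,X_n\big].$$ For real $z<0$, let $T_p(z)=\mathrm{diag}(T^{(1)}_p(z),\dots,T^{(p)}_p(z))$, where $\big((T_p^{(j)}(z))_{j\le p},(\widetilde T_n^{(i)}(z))_{i\le n}\big)$ is the unique solution with positive entries of $$T_p^{(j)}(z)=\frac{-1}{z\big(1+\frac1n\sum_{i=1}^n\gamma_{ij}^2\widetilde T_n^{(i)}(z)\big)},\qquad \widetilde T_n^{(i)}(z)=\frac{-1}{z\big(1+\frac1n\sum_{j=1}^p\gamma_{ij}^2T_p^{(j)}(z)\big)},$$ let $T_p'$ be the derivative of $T_p$ in $z$, and let $$r_\lambda^{test}(X_n)=\sigma^2+\frac{\sigma^2}{n}\mathrm{Tr}[\widetilde S_pT_p(-\lambda)]+\lambda\Big(\frac{\lambda\alpha^2}{p}-\frac{\sigma^2}{n}\Big)\mathrm{Tr}[\widetilde S_pT_p'(-\lambda)].$$ Then for every $\lambda>0$ the squared error $(\tilde y-\tilde x^\top\hat\theta_\lambda)^2$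 is integrable, the positive solution above exists, is unique, and $T_p$ is differentiable at $-\lambda$. Moreover, with $\lambda_\ast=\frac{\sigma^2p}{\alpha^2n}>0$, for every variance profile and every $\lambda>0$, $$\hat r^{test}_{\lambda_\ast}(X_n)\le\hat r^{test}_{\lambda}(X_n)\ \text{ almost surely},\qquad r^{test}_{\lambda_\ast}(X_n)\le r^{test}_{\lambda}(X_n).$$ The first inequality also holds on every realisation of $X_n$ and for all $\lambda>0$ simultaneously, for the version of the conditional expectation obtained by fixing the value of $X_n$ and integrating over $(\beta_\ast,\varepsilon_n,\tilde x,\tilde\varepsilon)$. -/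

import Mathlib

open MeasureTheory ProbabilityTheory
open scoped Matrix

noncomputable section

namespace RidgeVP

/-- Entrywise squared matrix: the variance profile `Γ = (γ_ij²)` of `X = Υ ∘ Z`. -/
def varProfile {n p : ℕ} (U : Matrix (Fin n) (Fin p) ℝ) : Matrix (Fin n) (Fin p) ℝ :=
  Matrix.of fun i j => U i j ^ 2

/-- The test covariance `S̃ = diag(γ̃_1², …, γ̃_p²)`. -/
def testCov {p : ℕ} (g : Fin p → ℝ) : Matrix (Fin p) (Fin p) ℝ :=
  Matrix.diagonal fun j => g j ^ 2

/-- The square root `S̃^{1/2}` of the (diagonal, nonnegative) test covariance. -/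
def testCovSqrt {p : ℕ} (g : Fin p → ℝ) : Matrix (Fin p) (Fin p) ℝ :=
  Matrix.diagonal fun j => Real.sqrt (g j ^ 2)

/-- The training features `X = Υ ∘ Z` (Hadamard product). -/
def features {n p : ℕ} (U Z : Matrix (Fin n) (Fin p) ℝ) : Matrix (Fin n) (Fin p) ℝ :=
  U ⊙ Z

/-- The test feature vector `x̃ = S̃^{1/2} z̃`. -/
def testFeature {p : ℕ} (g z : Fin p → ℝ) : Fin p → ℝ :=
  testCovSqrt g *ᵥ z

/-- The responses `Y = X β + ε` of the linear model. -/
def response {n p : ℕ} (X : Matrix (Fin n) (Fin p) ℝ) (b : Fin p → ℝ) (e : Fin n → ℝ) :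
    Fin n → ℝ :=
  X *ᵥ b + e

/-- The ridge objective `(1/n) ‖Y - X θ‖² + l ‖θ‖²` (Euclidean norms, written as dot products). -/
def ridgeObjective {n p : ℕ} (l : ℝ) (X : Matrix (Fin n) (Fin p) ℝ) (Y : Fin n → ℝ)
    (t : Fin p → ℝ) : ℝ :=
  (1 / (n : ℝ)) * ((Y - X *ᵥ t) ⬝ᵥ (Y - X *ᵥ t)) + l * (t ⬝ᵥ t)

/-- The ridge estimator `(Xᵀ X + n l I)⁻¹ Xᵀ Y`; for `l > 0` it is the unique minimiser of the
ridge objective, see `ridge_unique_min`. -/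
def ridge {n p : ℕ} (l : ℝ) (X : Matrix (Fin n) (Fin p) ℝ) (Y : Fin n → ℝ) : Fin p → ℝ :=
  (Xᵀ * X + ((n : ℝ) * l) • (1 : Matrix (Fin p) (Fin p) ℝ))⁻¹ *ᵥ (Xᵀ *ᵥ Y)

theorem ridge_posDef {n p : ℕ} (hn : 0 < n) {l : ℝ} (hl : 0 < l)
    (X : Matrix (Fin n) (Fin p) ℝ) :
    (Xᵀ * X + ((n : ℝ) * l) • (1 : Matrix (Fin p) (Fin p) ℝ)).PosDef := by
  have hc : 0 < (n : ℝ) * l := by positivity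
  have h1 : (Xᵀ * X).PosSemidef := by
    simpa using Matrix.posSemidef_conjTranspose_mul_self X
  exact Matrix.PosDef.posSemidef_add h1 (Matrix.PosDef.one.smul hc)

theorem ridge_normal_eq {n p : ℕ} (hn : 0 < n) {l : ℝ} (hl : 0 < l)
    (X : Matrix (Fin n) (Fin p) ℝ) (Y : Fin n → ℝ) :
    Xᵀ *ᵥ (Y - X *ᵥ ridge l X Y) = ((n : ℝ) * l) • ridge l X Y := by
  have hu := (ridge_posDef hn hl X).isUnit
  have hd := (Matrix.isUnit_iff_isUnit_det _).1 hu
  have h : (Xᵀ * X + ((n : ℝ) * l) • (1 : Matrix (Fin p) (Fin p) ℝ)) *ᵥ ridge l X Y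
      = Xᵀ *ᵥ Y := by
    rw [ridge, Matrix.mulVec_mulVec, Matrix.mul_nonsing_inv _ hd, Matrix.one_mulVec]
  rw [Matrix.mulVec_sub, ← h, Matrix.add_mulVec, Matrix.smul_mulVec, Matrix.one_mulVec,
    Matrix.mulVec_mulVec]
  abel

theorem ridge_unique_min {n p : ℕ} (hn : 0 < n) {l : ℝ} (hl : 0 < l)
    (X : Matrix (Fin n) (Fin p) ℝ) (Y : Fin n → ℝ) (t : Fin p → ℝ) (ht : t ≠ ridge l X Y) :
    ridgeObjective l X Y (ridge l X Y) < ridgeObjective l X Y t := by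
  have hn' : (0 : ℝ) < n := by exact_mod_cast hn
  have hne := ridge_normal_eq hn hl X Y
  set r := ridge l X Y with hr
  obtain ⟨d, rfl⟩ : ∃ d, t = r + d := ⟨t - r, by abel⟩
  have hd : d ≠ 0 := by rintro rfl; simp at ht
  have hpos : 0 < d ⬝ᵥ d := by
    have h0 : 0 ≤ d ⬝ᵥ d := Finset.sum_nonneg fun i _ => mul_self_nonneg _
    exact lt_of_le_of_ne h0 fun h => hd (dotProduct_self_eq_zero.1 h.symm)
  have hX : 0 ≤ (X *ᵥ d) ⬝ᵥ (X *ᵥ d) := Finset.sum_nonneg fun i _ => mul_self_nonneg _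
  have hcross : (Y - X *ᵥ r) ⬝ᵥ (X *ᵥ d) = (n : ℝ) * l * (r ⬝ᵥ d) := by
    rw [Matrix.dotProduct_mulVec, ← Matrix.mulVec_transpose, hne, smul_dotProduct, smul_eq_mul]
  have e : Y - X *ᵥ (r + d) = (Y - X *ᵥ r) - X *ᵥ d := by
    rw [Matrix.mulVec_add]; abel
  have key : ridgeObjective l X Y (r + d) = ridgeObjective l X Y r
      + (1 / (n : ℝ)) * ((X *ᵥ d) ⬝ᵥ (X *ᵥ d)) + l * (d ⬝ᵥ d) := by
    unfold ridgeObjective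
    rw [e]
    generalize Y - X *ᵥ r = w at *
    simp only [sub_dotProduct, dotProduct_sub, add_dotProduct, dotProduct_add]
    rw [dotProduct_comm (X *ᵥ d) w, dotProduct_comm d r, hcross]
    field_simp
    ring
  rw [key]
  have h1 : 0 ≤ (1 / (n : ℝ)) * ((X *ᵥ d) ⬝ᵥ (X *ᵥ d)) := by positivity
  have h2 : 0 < l * (d ⬝ᵥ d) := by positivity
  linarith

/-- The probabilistic model, for one sample size `n` and one dimension `p`.
`U = Υ`, `g = γ̃`, `Z` = standardised training features, `e = ε_n`, `b = β_*`,
`z = z̃`, `et = ε̃`. -/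
structure IsModel {Ω : Type*} [MeasurableSpace Ω] (P : Measure Ω) {n p : ℕ}
    (U : Matrix (Fin n) (Fin p) ℝ) (g : Fin p → ℝ) (α σ : ℝ)
    (Z : Ω → Matrix (Fin n) (Fin p) ℝ) (e : Ω → Fin n → ℝ) (b : Ω → Fin p → ℝ)
    (z : Ω → Fin p → ℝ) (et : Ω → ℝ) : Prop where
  meas_Z : ∀ i j, Measurable fun ω => Z ω i j
  meas_e : Measurable e
  meas_b : Measurable b
  meas_z : Measurable z
  meas_et : Measurable et
  /- the entries of `Z` are iid, centred, of variance one, with a moment of order `> 4`,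
  and so are those of `z̃` -/
  indep_Z : iIndepFun (fun (k : Fin n × Fin p) ω => Z ω k.1 k.2) P
  ident_Z : ∀ i j i' j', IdentDistrib (fun ω => Z ω i j) (fun ω => Z ω i' j') P P
  mean_Z : ∀ i j, ∫ ω, Z ω i j ∂P = 0
  var_Z : ∀ i j, ∫ ω, Z ω i j ^ 2 ∂P = 1
  indep_z : iIndepFun (fun j ω => z ω j) P
  ident_z : ∀ j j', IdentDistrib (fun ω => z ω j) (fun ω => z ω j') P P
  mean_z : ∀ j, ∫ ω, z ω j ∂P = 0
  var_z : ∀ j, ∫ ω, z ω j ^ 2 ∂P = 1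
  moment : ∃ δ : ℝ, 0 < δ ∧
    (∀ i j, Integrable (fun ω => |Z ω i j| ^ (4 + δ)) P) ∧
    (∀ j, Integrable (fun ω => |z ω j| ^ (4 + δ)) P)
  /- training noise: centred with covariance `σ² I` -/
  sq_e : ∀ i, MemLp (fun ω => e ω i) 2 P
  mean_e : ∀ i, ∫ ω, e ω i ∂P = 0
  cov_e : ∀ i i', ∫ ω, e ω i * e ω i' ∂P = if i = i' then σ ^ 2 else 0
  /- test noise: centred with variance `σ²` -/
  sq_et : MemLp et 2 P
  mean_et : ∫ ω, et ω ∂P = 0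
  var_et : ∫ ω, et ω ^ 2 ∂P = σ ^ 2
  /- regression coefficients: centred with covariance `(α²/p) I` -/
  sq_b : ∀ j, MemLp (fun ω => b ω j) 2 P
  mean_b : ∀ j, ∫ ω, b ω j ∂P = 0
  cov_b : ∀ j j', ∫ ω, b ω j * b ω j' ∂P = if j = j' then α ^ 2 / p else 0
  /- independence of `X_n`, `ε_n`, `β_*`, `x̃`, `ε̃` -/
  indep_noise : IndepFun e (fun ω i j => features U (Z ω) i j) P
  indep_test_noise : IndepFun (fun ω => testFeature g (z ω)) et P
  indep_test_train : IndepFun (fun ω => (testFeature g (z ω), et ω))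
    (fun ω => ((fun i j => features U (Z ω) i j : Fin n → Fin p → ℝ), e ω)) P
  indep_b : IndepFun b
    (fun ω => ((fun i j => features U (Z ω) i j : Fin n → Fin p → ℝ), e ω,
      testFeature g (z ω), et ω)) P

/-- The squared prediction error `(ỹ - x̃ᵀ θ̂_l)²` when the ridge estimator is fitted on features
`X`, coefficients `b` and noise `e`, and `ỹ = x̃ᵀ b + ε̃`. -/
def sqError {n p : ℕ} (l : ℝ) (X : Matrix (Fin n) (Fin p) ℝ) (b : Fin p → ℝ) (e : Fin n → ℝ)
    (xt : Fin p → ℝ) (et : ℝ) : ℝ :=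
  ((xt ⬝ᵥ b + et) - xt ⬝ᵥ ridge l X (response X b e)) ^ 2

/-- The random squared prediction error `(ỹ - x̃ᵀ θ̂_l)²` of the model. -/
def modelError {Ω : Type*} {n p : ℕ} (U : Matrix (Fin n) (Fin p) ℝ) (g : Fin p → ℝ)
    (Z : Ω → Matrix (Fin n) (Fin p) ℝ) (e : Ω → Fin n → ℝ) (b : Ω → Fin p → ℝ)
    (z : Ω → Fin p → ℝ) (et : Ω → ℝ) (l : ℝ) (ω : Ω) : ℝ :=
  sqError l (features U (Z ω)) (b ω) (e ω) (testFeature g (z ω)) (et ω)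

/-- The σ-algebra generated by the training features `X_n = Υ ∘ Z`. -/
@[reducible] def featuresSigma {Ω : Type*} {n p : ℕ} (U : Matrix (Fin n) (Fin p) ℝ)
    (Z : Ω → Matrix (Fin n) (Fin p) ℝ) : MeasurableSpace Ω :=
  MeasurableSpace.comap (fun ω => (fun i j => features U (Z ω) i j : Fin n → Fin p → ℝ))
    inferInstance

/-- The empirical predictive risk `r̂_l^test(X_n) = E[(ỹ - x̃ᵀ θ̂_l)² | X_n]`. -/
def empRisk {Ω : Type*} [MeasurableSpace Ω] (P : Measure Ω) {n p : ℕ}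
    (U : Matrix (Fin n) (Fin p) ℝ) (g : Fin p → ℝ)
    (Z : Ω → Matrix (Fin n) (Fin p) ℝ) (e : Ω → Fin n → ℝ) (b : Ω → Fin p → ℝ)
    (z : Ω → Fin p → ℝ) (et : Ω → ℝ) (l : ℝ) : Ω → ℝ :=
  P[modelError U g Z e b z et l | featuresSigma U Z]

/-- The same risk at a fixed value `A` of the features: the expectation over `β_*`, `ε_n`, `x̃`,
`ε̃` only. -/
def riskGiven {Ω : Type*} [MeasurableSpace Ω] (P : Measure Ω) {n p : ℕ} (g : Fin p → ℝ)
    (e : Ω → Fin n → ℝ) (b : Ω → Fin p → ℝ) (z : Ω → Fin p → ℝ) (et : Ω → ℝ)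
    (l : ℝ) (A : Matrix (Fin n) (Fin p) ℝ) : ℝ :=
  ∫ ω, sqError l A (b ω) (e ω) (testFeature g (z ω)) (et ω) ∂P

/-- `(T, T̃)` solves, at a negative real `x`, the system
`T_j = -1 / (x (1 + (1/n) Tr[D̃_j T̃]))`, `T̃_i = -1 / (x (1 + (1/n) Tr[D_i T]))`,
`D̃_j = diag(Γ_1j, …, Γ_nj)`, `D_i = diag(Γ_i1, …, Γ_ip)`. Positivity singles out the relevant
solution: a Stieltjes transform of a probability measure on `[0, ∞)` is positive at `x < 0`. -/
structure IsDyson {n p : ℕ} (Γ : Matrix (Fin n) (Fin p) ℝ) (x : ℝ)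
    (s : (Fin p → ℝ) × (Fin n → ℝ)) : Prop where
  pos_left : ∀ j, 0 < s.1 j
  pos_right : ∀ i, 0 < s.2 i
  eq_left : ∀ j, s.1 j = -1 / (x * (1 + (1 / (n : ℝ)) *
    Matrix.trace (Matrix.diagonal (fun i => Γ i j) * Matrix.diagonal s.2)))
  eq_right : ∀ i, s.2 i = -1 / (x * (1 + (1 / (n : ℝ)) *
    Matrix.trace (Matrix.diagonal (fun j => Γ i j) * Matrix.diagonal s.1)))

/-- The diagonal of `T_p(x)` for real `x < 0`. -/
def dysonT {n p : ℕ} (Γ : Matrix (Fin n) (Fin p) ℝ) (x : ℝ) : Fin p → ℝ :=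
  (Classical.epsilon (IsDyson Γ x)).1

/-- The diagonal of the derivative `T_p'(x)`, for real `x < 0`. -/
def dysonT' {n p : ℕ} (Γ : Matrix (Fin n) (Fin p) ℝ) (x : ℝ) : Fin p → ℝ :=
  fun j => deriv (fun y => dysonT Γ y j) x

/-- The deterministic equivalent `r_l^test(X_n)` of the predictive risk. -/
def detRisk {n p : ℕ} (U : Matrix (Fin n) (Fin p) ℝ) (g : Fin p → ℝ) (α σ l : ℝ) : ℝ :=
  σ ^ 2 + σ ^ 2 / n *
      Matrix.trace (testCov g * Matrix.diagonal (dysonT (varProfile U) (-l)))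
    + l * (l * α ^ 2 / p - σ ^ 2 / n) *
      Matrix.trace (testCov g * Matrix.diagonal (dysonT' (varProfile U) (-l)))

/-- The claimed optimal regularisation `σ² p / (α² n)`. -/
def optLambda (n p : ℕ) (α σ : ℝ) : ℝ := σ ^ 2 * p / (α ^ 2 * n)

end RidgeVP

end

/-! The two inequalities have independent proofs.

Empirical risk. Fix the value `A` of the features. Every ridge estimator is linear in the responses
`Y`, and the optimal linear predictor of `β` from `Y` is the matrix `K` with `K Cov(Y) = Cov(β, Y)`,
where `Cov(Y) = (α²/p) A Aᵀ + σ² I` and `Cov(β, Y) = (α²/p) Aᵀ`. Ridge satisfies this equation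
exactly when `n λ α²/p = σ²`, that is at `λ_*` (`ridge_optLambda_normal_eq`). Its prediction error
is then orthogonal in `L²` to every difference of linear predictions, so Pythagoras gives minimality
among all linear estimators (`integral_sq_error_le`). Independence identifies the conditional
expectation with the risk at fixed features, which transfers the inequality.

Deterministic risk. With `u(λ) = λ T(-λ)`, the risk at `λ` equals `σ² + (α²/p) ∑ γ̃_j² (u_j(λ) +
(λ_* - λ) u_j'(λ))` (`detRisk_eq`): up to constants it is the tangent to `∑ γ̃_j² u_j` at `λ`,
evaluated at `λ_*`. If each `u_j` is concave, every such tangent lies above the value at `λ_*`,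
which is attained for `λ = λ_*`.

Concavity comes from the fixed point equation `u = F(λ, u)` obtained by eliminating the companion
unknowns. The map `F` is monotone and strictly subhomogeneous in `u`, which gives a comparison
principle between subsolutions and supersolutions, hence uniqueness. It is also jointly concave in
`(λ, u)`, so convex combinations of solutions are subsolutions and lie below the solution at the
averaged parameter. Differentiability follows from the implicit function theorem. -/

noncomputable section

namespace RidgeVP

/-! ### The Dyson fixed point equation: existence, uniqueness, smoothness, concavity -/

section Dyson

variable {ι κ : Type*} [Fintype κ]

/-- The `i`-th denominator `l + ∑ k, a i k * u k` of the Dyson system. -/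
def dysonDen (a : ι → κ → ℝ) (l : ℝ) (u : κ → ℝ) (i : ι) : ℝ := l + ∑ k, a i k * u k

variable {a : ι → κ → ℝ} {l : ℝ} {u v : κ → ℝ}

theorem dysonDen_pos (ha : ∀ i j, 0 ≤ a i j) (hl : 0 < l) (hu : 0 ≤ u) (i : ι) :
    0 < dysonDen a l u i :=
  add_pos_of_pos_of_nonneg hl (Finset.sum_nonneg fun k _ => mul_nonneg (ha i k) (hu k))

variable [Fintype ι]

/-- The map whose fixed point is `u = l T(-l)`, after elimination of the companion unknowns. -/
def dysonMap (a : ι → κ → ℝ) (l : ℝ) (u : κ → ℝ) (j : κ) : ℝ :=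
  (1 + ∑ i, a i j / dysonDen a l u i)⁻¹

theorem one_le_dysonMap_inv (ha : ∀ i j, 0 ≤ a i j) (hl : 0 < l) (hu : 0 ≤ u) (j : κ) :
    1 ≤ 1 + ∑ i, a i j / dysonDen a l u i :=
  le_add_of_nonneg_right
    (Finset.sum_nonneg fun i _ => div_nonneg (ha i j) (dysonDen_pos ha hl hu i).le)

theorem dysonMap_pos (ha : ∀ i j, 0 ≤ a i j) (hl : 0 < l) (hu : 0 ≤ u) (j : κ) :
    0 < dysonMap a l u j :=
  inv_pos.2 (zero_lt_one.trans_le (one_le_dysonMap_inv ha hl hu j))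

theorem dysonMap_le_one (ha : ∀ i j, 0 ≤ a i j) (hl : 0 < l) (hu : 0 ≤ u) (j : κ) :
    dysonMap a l u j ≤ 1 :=
  inv_le_one_of_one_le₀ (one_le_dysonMap_inv ha hl hu j)

theorem dysonMap_mono (ha : ∀ i j, 0 ≤ a i j) (hl : 0 < l) (hu : 0 ≤ u) (huv : u ≤ v) :
    dysonMap a l u ≤ dysonMap a l v := fun j => by
  have hv : 0 ≤ v := hu.trans huv
  refine inv_anti₀ (zero_lt_one.trans_le (one_le_dysonMap_inv ha hl hv j)) ?_
  refine add_le_add_right (Finset.sum_le_sum fun i _ => ?_) 1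
  refine div_le_div_of_nonneg_left (ha i j) (dysonDen_pos ha hl hu i) ?_
  exact add_le_add_right (Finset.sum_le_sum fun k _ => mul_le_mul_of_nonneg_left (huv k) (ha i k)) l

/-- Strict subhomogeneity. The denominators at `t • u` are at least `t` times those at `u`, because
`l` is not scaled; strictness comes from the constant `1` in the map. -/
theorem mul_dysonMap_lt (ha : ∀ i j, 0 ≤ a i j) (hl : 0 < l) (hu : 0 ≤ u) {t : ℝ} (ht : 0 < t)
    (ht1 : t < 1) (j : κ) : t * dysonMap a l u j < dysonMap a l (t • u) j := by
  have htu : 0 ≤ t • u := smul_nonneg ht.le hu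
  have h1 := one_le_dysonMap_inv ha hl hu j
  have h2 := one_le_dysonMap_inv ha hl htu j
  unfold dysonMap
  rw [← div_eq_mul_inv, div_lt_iff₀ (by linarith), mul_comm, ← div_eq_mul_inv,
    lt_div_iff₀ (by linarith), mul_add, Finset.mul_sum]
  refine add_lt_add_of_lt_of_le (by linarith) (Finset.sum_le_sum fun i _ => ?_)
  have hd := dysonDen_pos ha hl hu i
  have hd' := dysonDen_pos ha hl htu i
  have hden : dysonDen a l (t • u) i = l + t * ∑ k, a i k * u k := by
    simp only [dysonDen, Pi.smul_apply, smul_eq_mul, Finset.mul_sum]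
    congr 1; exact Finset.sum_congr rfl fun k _ => by ring
  rw [mul_div_assoc', div_le_div_iff₀ hd' hd, hden]
  have : t * dysonDen a l u i ≤ l + t * ∑ k, a i k * u k := by
    unfold dysonDen; nlinarith
  nlinarith [ha i j]

/-- Comparison principle: a positive subsolution lies below every positive supersolution. -/
theorem le_of_le_dysonMap_of_dysonMap_le (ha : ∀ i j, 0 ≤ a i j) (hl : 0 < l)
    (hu : ∀ j, 0 < u j) (hv : ∀ j, 0 < v j)
    (hvm : v ≤ dysonMap a l v) (hum : dysonMap a l u ≤ u) : v ≤ u := by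
  intro j₀
  -- The smallest ratio `t` makes `t • v` touch `u` from below at `j`. If `t < 1`, then `u j = t * v
  -- j ≤ t * F(v) j < F(t • v) j ≤ F(u) j ≤ u j`, a contradiction.
  obtain ⟨j, -, hj⟩ := Finset.exists_min_image Finset.univ (fun j => u j / v j) ⟨j₀, Finset.mem_univ _⟩
  set t := u j / v j with ht
  have htpos : 0 < t := div_pos (hu j) (hv j)
  have htv : t • v ≤ u := fun k => (le_div_iff₀ (hv k)).1 (hj k (Finset.mem_univ k))
  have h1t : 1 ≤ t := by
    by_contra! hlt
    have hv0 : 0 ≤ v := fun k => (hv k).le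
    have h1 := mul_dysonMap_lt ha hl hv0 htpos hlt j
    have h2 := dysonMap_mono ha hl (smul_nonneg htpos.le hv0) htv j
    have h3 : t * v j ≤ t * dysonMap a l v j := mul_le_mul_of_nonneg_left (hvm j) htpos.le
    have h4 : t * v j = u j := div_mul_cancel₀ _ (hv j).ne'
    linarith [hum j]
  calc v j₀ ≤ t * v j₀ := le_mul_of_one_le_left (hv j₀).le h1t
    _ ≤ u j₀ := htv j₀

theorem dysonMap_fixed_unique (ha : ∀ i j, 0 ≤ a i j) (hl : 0 < l)
    (hu : ∀ j, 0 < u j) (hv : ∀ j, 0 < v j)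
    (hum : dysonMap a l u = u) (hvm : dysonMap a l v = v) : u = v :=
  le_antisymm (le_of_le_dysonMap_of_dysonMap_le ha hl hv hu hum.ge hvm.le)
    (le_of_le_dysonMap_of_dysonMap_le ha hl hu hv hvm.ge hum.le)

/-- Knaster–Tarski: the map is monotone on the complete lattice `[0,1]^κ`. Positivity is automatic,
since all values of the map are positive. -/
theorem exists_dysonMap_fixed (ha : ∀ i j, 0 ≤ a i j) (hl : 0 < l) :
    ∃ u : κ → ℝ, (∀ j, 0 < u j) ∧ dysonMap a l u = u := by
  have : Fact ((0 : ℝ) ≤ 1) := ⟨zero_le_one⟩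
  let f : (κ → Set.Icc (0 : ℝ) 1) →o (κ → Set.Icc (0 : ℝ) 1) :=
    { toFun := fun w j => ⟨dysonMap a l (fun k => (w k : ℝ)) j,
        (dysonMap_pos ha hl (fun k => (w k).2.1) j).le,
        dysonMap_le_one ha hl (fun k => (w k).2.1) j⟩
      monotone' := fun w w' h j =>
        dysonMap_mono ha hl (fun k => (w k).2.1) (fun k => h k) j }
  have hf : dysonMap a l (fun k => (f.lfp k : ℝ)) = fun k => (f.lfp k : ℝ) := by
    funext j
    exact congrArg Subtype.val (congrFun f.map_lfp j)
  refine ⟨fun k => (f.lfp k : ℝ), fun j => ?_, hf⟩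
  have := dysonMap_pos ha hl (u := fun k => (f.lfp k : ℝ)) (fun k => (f.lfp k).2.1) j
  rwa [hf] at this

/-- Joint convexity of `(A, x) ↦ A² / x`, the source of the concavity of the Dyson map. -/
theorem sq_convexComb_div_le {s t A B x y : ℝ} (hs : 0 ≤ s) (ht : 0 ≤ t) (hst : s + t = 1)
    (hx : 0 < x) (hy : 0 < y) :
    (s * A + t * B) ^ 2 / (s * x + t * y) ≤ s * (A ^ 2 / x) + t * (B ^ 2 / y) := by
  have hpos : 0 < s * x + t * y := by
    rcases hs.eq_or_lt with rfl | hs'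
    · have : t = 1 := by linarith
      subst this; linarith
    · exact add_pos_of_pos_of_nonneg (mul_pos hs' hx) (mul_nonneg ht hy.le)
  rw [div_le_iff₀ hpos]
  have key : (s * (A ^ 2 / x) + t * (B ^ 2 / y)) * (s * x + t * y) - (s * A + t * B) ^ 2
      = s * t * (A * y - B * x) ^ 2 / (x * y) := by
    field_simp; ring
  have : 0 ≤ s * t * (A * y - B * x) ^ 2 / (x * y) := by positivity
  linarith

/-- The Dyson map is jointly concave in `(l, u)`. -/
theorem convexComb_dysonMap_le (ha : ∀ i j, 0 ≤ a i j) {l' : ℝ} (hl : 0 < l) (hl' : 0 < l')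
    (hu : 0 ≤ u) (hv : 0 ≤ v) {s t : ℝ} (hs : 0 ≤ s) (ht : 0 ≤ t) (hst : s + t = 1) (j : κ) :
    s * dysonMap a l u j + t * dysonMap a l' v j
      ≤ dysonMap a (s * l + t * l') (s • u + t • v) j := by
  set A := dysonMap a l u j with hA
  set B := dysonMap a l' v j with hB
  have hApos : 0 < A := dysonMap_pos ha hl hu j
  have hBpos : 0 < B := dysonMap_pos ha hl' hv j
  have hC : 0 < s * A + t * B := by
    rcases hs.eq_or_lt with rfl | hs'
    · have : t = 1 := by linarith
      subst this; linarith
    · exact add_pos_of_pos_of_nonneg (mul_pos hs' hApos) (mul_nonneg ht hBpos.le)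
  have hL : 0 < s * l + t * l' := by
    rcases hs.eq_or_lt with rfl | hs'
    · have : t = 1 := by linarith
      subst this; linarith
    · exact add_pos_of_pos_of_nonneg (mul_pos hs' hl) (mul_nonneg ht hl'.le)
  have hw : 0 ≤ s • u + t • v := add_nonneg (smul_nonneg hs hu) (smul_nonneg ht hv)
  have hden : ∀ i, dysonDen a (s * l + t * l') (s • u + t • v) i
      = s * dysonDen a l u i + t * dysonDen a l' v i := fun i => by
    simp only [dysonDen, Pi.add_apply, Pi.smul_apply, smul_eq_mul, mul_add, Finset.mul_sum,
      Finset.sum_add_distrib]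
    have h1 : ∀ (r : ℝ) (w : κ → ℝ), ∑ k, a i k * (r * w k) = ∑ k, r * (a i k * w k) :=
      fun r w => Finset.sum_congr rfl fun k _ => by ring
    rw [h1, h1]; ring
  have hSA : A ^ 2 * (1 + ∑ i, a i j / dysonDen a l u i) = A := by
    have : A * (1 + ∑ i, a i j / dysonDen a l u i) = 1 :=
      inv_mul_cancel₀ (zero_lt_one.trans_le (one_le_dysonMap_inv ha hl hu j)).ne'
    rw [sq, mul_assoc, this, mul_one]
  have hSB : B ^ 2 * (1 + ∑ i, a i j / dysonDen a l' v i) = B := by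
    have : B * (1 + ∑ i, a i j / dysonDen a l' v i) = 1 :=
      inv_mul_cancel₀ (zero_lt_one.trans_le (one_le_dysonMap_inv ha hl' hv j)).ne'
    rw [sq, mul_assoc, this, mul_one]
  have hone : (s * A + t * B) ^ 2 ≤ s * A ^ 2 + t * B ^ 2 := by
    simpa [hst] using sq_convexComb_div_le (A := A) (B := B) hs ht hst one_pos one_pos
  -- With `C = s * A + t * B`, convexity of the square over a linear form bounds `C²` times the new
  -- reciprocal by `s` times `A²` times the old one plus `t` times the `B` analogue. By `hSA` and
  -- `hSB` this is `C`; dividing by `C` gives the claim.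
  have hmain : (s * A + t * B) ^ 2
      * (1 + ∑ i, a i j / dysonDen a (s * l + t * l') (s • u + t • v) i) ≤ s * A + t * B := by
    have hsum : (s * A + t * B) ^ 2 * ∑ i, a i j / dysonDen a (s * l + t * l') (s • u + t • v) i
        ≤ s * (A ^ 2 * ∑ i, a i j / dysonDen a l u i)
          + t * (B ^ 2 * ∑ i, a i j / dysonDen a l' v i) := by
      simp only [Finset.mul_sum, ← Finset.sum_add_distrib]
      refine Finset.sum_le_sum fun i _ => ?_
      have h := mul_le_mul_of_nonneg_left (sq_convexComb_div_le (A := A) (B := B) hs ht hst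
        (dysonDen_pos ha hl hu i) (dysonDen_pos ha hl' hv i)) (ha i j)
      rw [hden i]
      calc _ = a i j * ((s * A + t * B) ^ 2 / (s * dysonDen a l u i + t * dysonDen a l' v i)) := by
            ring
        _ ≤ _ := h
        _ = _ := by ring
    nlinarith
  have hpos := zero_lt_one.trans_le (one_le_dysonMap_inv ha hL hw j)
  unfold dysonMap
  rw [le_inv_comm₀ hC hpos, ← one_div, le_div_iff₀ hC]
  nlinarith

theorem hasDerivAt_dysonMap_line (ha : ∀ i j, 0 ≤ a i j) (hl : 0 < l) (hu : 0 ≤ u)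
    (w : κ → ℝ) (j : κ) :
    HasDerivAt (fun t : ℝ => dysonMap a l (u + t • w) j)
      (dysonMap a l u j ^ 2 * ∑ i, a i j * (∑ k, a i k * w k) / dysonDen a l u i ^ 2) 0 := by
  have hden : ∀ i, HasDerivAt (fun t : ℝ => dysonDen a l (u + t • w) i) (∑ k, a i k * w k) 0 := by
    intro i
    unfold dysonDen
    refine HasDerivAt.const_add _ (HasDerivAt.fun_sum fun k _ => ?_)
    have h : HasDerivAt (fun t : ℝ => u k + t * w k) (w k) 0 := by
      simpa using ((hasDerivAt_id (0 : ℝ)).mul_const (w k)).const_add (u k)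
    exact h.const_mul (a i k)
  have h0 : u + (0 : ℝ) • w = u := by simp
  have hsum : HasDerivAt (fun t : ℝ => 1 + ∑ i, a i j / dysonDen a l (u + t • w) i)
      (∑ i, -(a i j * (∑ k, a i k * w k) / dysonDen a l u i ^ 2)) 0 := by
    refine HasDerivAt.const_add _ (HasDerivAt.fun_sum fun i _ => ?_)
    have h := (hasDerivAt_const (0 : ℝ) (a i j)).div (hden i)
      (by rw [h0]; exact (dysonDen_pos ha hl hu i).ne')
    rw [h0] at h
    exact h.congr_deriv (by ring)
  have h := hsum.fun_inv (by
    rw [h0]; exact (zero_lt_one.trans_le (one_le_dysonMap_inv ha hl hu j)).ne')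
  rw [h0] at h
  refine h.congr_deriv ?_
  rw [Finset.sum_neg_distrib, neg_neg, dysonMap, inv_pow, div_eq_mul_inv, mul_comm]

/-- At a positive fixed point, `1` is not an eigenvalue of the linearised Dyson map. -/
theorem eq_zero_of_linearized_fixed (ha : ∀ i j, 0 ≤ a i j) (hl : 0 < l) (hu : ∀ j, 0 < u j)
    (hum : dysonMap a l u = u) {w : κ → ℝ}
    (hw : ∀ j, dysonMap a l u j ^ 2 * ∑ i, a i j * (∑ k, a i k * w k) / dysonDen a l u i ^ 2
      = w j) : w = 0 := by
  rcases isEmpty_or_nonempty κ with hκ | hκ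
  · exact Subsingleton.elim _ _
  have hu0 : 0 ≤ u := fun j => (hu j).le
  -- Maximum principle in the norm weighted by `u`: where `|w j| / u j` attains its maximum `m`, the
  -- linearised equation gives `m u_j ≤ m u_j (1 - u_j)`, which forces `m = 0`.
  obtain ⟨j, -, hj⟩ := Finset.exists_max_image Finset.univ (fun j => |w j| / u j)
    Finset.univ_nonempty
  set m := |w j| / u j with hm
  have hm0 : 0 ≤ m := div_nonneg (abs_nonneg _) (hu j).le
  have hle : ∀ k, |w k| ≤ m * u k := fun k => (div_le_iff₀ (hu k)).1 (hj k (Finset.mem_univ k))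
  have hmj : |w j| = m * u j := (div_mul_cancel₀ _ (hu j).ne').symm
  have hS : u j * (1 + ∑ i, a i j / dysonDen a l u i) = 1 := by
    have : dysonMap a l u j * (1 + ∑ i, a i j / dysonDen a l u i) = 1 :=
      inv_mul_cancel₀ (zero_lt_one.trans_le (one_le_dysonMap_inv ha hl hu0 j)).ne'
    rwa [hum] at this
  have hbound : |w j| ≤ u j ^ 2 * (m * ∑ i, a i j / dysonDen a l u i) := by
    have h := hw j
    rw [hum] at h
    rw [← h, abs_mul, abs_of_nonneg (sq_nonneg _)]
    refine mul_le_mul_of_nonneg_left ?_ (sq_nonneg _)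
    rw [Finset.mul_sum]
    refine (Finset.abs_sum_le_sum_abs _ _).trans (Finset.sum_le_sum fun i _ => ?_)
    have hd := dysonDen_pos ha hl hu0 i
    have h1 : |∑ k, a i k * w k| ≤ m * dysonDen a l u i := by
      calc |∑ k, a i k * w k| ≤ ∑ k, |a i k * w k| := Finset.abs_sum_le_sum_abs _ _
        _ ≤ ∑ k, m * (a i k * u k) := Finset.sum_le_sum fun k _ => by
            rw [abs_mul, abs_of_nonneg (ha i k)]
            calc a i k * |w k| ≤ a i k * (m * u k) := mul_le_mul_of_nonneg_left (hle k) (ha i k)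
              _ = _ := by ring
        _ = m * ∑ k, a i k * u k := by rw [Finset.mul_sum]
        _ ≤ m * dysonDen a l u i :=
            mul_le_mul_of_nonneg_left (le_add_of_nonneg_left hl.le) hm0
    rw [abs_div, abs_mul, abs_of_nonneg (ha i j), abs_of_nonneg (sq_nonneg (dysonDen a l u i)),
      div_le_iff₀ (by positivity)]
    calc a i j * |∑ k, a i k * w k| ≤ a i j * (m * dysonDen a l u i) :=
          mul_le_mul_of_nonneg_left h1 (ha i j)
      _ = m * (a i j / dysonDen a l u i) * dysonDen a l u i ^ 2 := by field_simp
  have hmz : m = 0 := by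
    have h1 : m * u j ≤ m * u j * (1 - u j) := by
      have : u j * ∑ i, a i j / dysonDen a l u i = 1 - u j := by linarith
      calc m * u j ≤ u j ^ 2 * (m * ∑ i, a i j / dysonDen a l u i) := hmj ▸ hbound
        _ = m * u j * (u j * ∑ i, a i j / dysonDen a l u i) := by ring
        _ = _ := by rw [this]
    have h2 : 0 < u j * u j := mul_pos (hu j) (hu j)
    nlinarith
  funext k
  have := hle k
  rw [hmz, zero_mul] at this
  exact abs_nonpos_iff.1 this

theorem contDiffAt_dysonMap (ha : ∀ i j, 0 ≤ a i j) (hl : 0 < l) (hu : 0 ≤ u) :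
    ContDiffAt ℝ 1 (fun q : ℝ × (κ → ℝ) => dysonMap a q.1 q.2) (l, u) := by
  refine contDiffAt_pi.2 fun j => ?_
  unfold dysonMap
  refine ContDiffAt.inv (contDiffAt_const.add (ContDiffAt.sum fun i _ => ?_))
    (zero_lt_one.trans_le (one_le_dysonMap_inv ha hl hu j)).ne'
  refine ContDiffAt.div contDiffAt_const ?_ (dysonDen_pos ha hl hu i).ne'
  unfold dysonDen
  fun_prop

/-- The fixed points of the Dyson map depend differentiably on the parameter. -/
theorem differentiableAt_dysonMap_fixed (ha : ∀ i j, 0 ≤ a i j) {U : ℝ → κ → ℝ}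
    (hpos : ∀ x, 0 < x → ∀ j, 0 < U x j) (hfix : ∀ x, 0 < x → dysonMap a x (U x) = U x)
    (hl : 0 < l) : DifferentiableAt ℝ U l := by
  set F : ℝ × (κ → ℝ) → κ → ℝ := fun q => q.2 - dysonMap a q.1 q.2 with hF
  have hU0 : 0 ≤ U l := fun j => (hpos l hl j).le
  have hC : ContDiffAt ℝ 1 F (l, U l) := contDiffAt_snd.sub (contDiffAt_dysonMap ha hl hU0)
  have hd := hC.hasStrictFDerivAt one_ne_zero
  set F' := fderiv ℝ F (l, U l) with hF'
  -- The partial derivative of `F` in `u` is the identity minus the linearised Dyson map; a kernel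
  -- vector, tested along the line `U l + t • w`, is fixed by the linearisation and so vanishes.
  have hker : ∀ w, (F' ∘L .inr ℝ ℝ (κ → ℝ)) w = 0 → w = 0 := by
    intro w hw
    refine eq_zero_of_linearized_fixed ha hl (hpos l hl) (hfix l hl) fun j => ?_
    have hline : HasDerivAt (fun t : ℝ => ((l, U l + t • w) : ℝ × (κ → ℝ))) (0, w) 0 := by
      refine (hasDerivAt_const _ _).prodMk ?_
      simpa using ((hasDerivAt_id (0 : ℝ)).smul_const w).const_add (U l)
    have hd0 : HasFDerivAt F F' ((fun t : ℝ => ((l, U l + t • w) : ℝ × (κ → ℝ))) 0) := by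
      simpa using hd.hasFDerivAt
    have h1 := hasDerivAt_pi.1 (hd0.comp_hasDerivAt (0 : ℝ) hline) j
    have h2 : HasDerivAt (fun t : ℝ => U l j + t * w j - dysonMap a l (U l + t • w) j)
        (w j - dysonMap a l (U l) j ^ 2 *
          ∑ i, a i j * (∑ k, a i k * w k) / dysonDen a l (U l) i ^ 2) 0 := by
      refine HasDerivAt.sub ?_ (hasDerivAt_dysonMap_line ha hl hU0 w j)
      simpa using ((hasDerivAt_id (0 : ℝ)).mul_const (w j)).const_add (U l j)
    have h3 := h1.unique h2
    have h4 : F' (0, w) j = 0 := congrFun hw j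
    rw [h4] at h3
    linarith
  have hinv : (F' ∘L .inr ℝ ℝ (κ → ℝ)).IsInvertible := by
    have hinj : Function.Injective (F' ∘L .inr ℝ ℝ (κ → ℝ)).toLinearMap :=
      (injective_iff_map_eq_zero _).2 hker
    exact ⟨(LinearEquiv.ofInjectiveEndo _ hinj).toContinuousLinearEquiv, by ext; rfl⟩
  set ψ := hd.implicitFunctionOfProdDomain hinv with hψ
  have hFl : F (l, U l) = 0 := by simp [hF, hfix l hl]
  have hψd : DifferentiableAt ℝ ψ l :=
    (hd.hasStrictFDerivAt_implicitFunctionOfProdDomain hinv).hasFDerivAt.differentiableAt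
  have hψt := hd.tendsto_implicitFunctionOfProdDomain hinv
  -- Continuity of `U` need not be known beforehand: the implicit function stays positive near `l`
  -- and solves the fixed point equation, so uniqueness identifies it with `U`.
  refine hψd.congr_of_eventuallyEq ?_
  have hev : ∀ᶠ x in nhds l, ∀ j, 0 < ψ x j := by
    refine Filter.eventually_all.2 fun j => ?_
    exact ((tendsto_pi_nhds.1 hψt) j).eventually (lt_mem_nhds (hpos l hl j))
  filter_upwards [hev, lt_mem_nhds hl, hd.eventually_apply_implicitFunctionOfProdDomain hinv]
    with x hx1 hx2 hx3
  rw [hFl] at hx3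
  exact dysonMap_fixed_unique ha hx2 (hpos x hx2) hx1 (hfix x hx2) (sub_eq_zero.1 hx3).symm

/-- The fixed points of the Dyson map are concave in the parameter. -/
theorem concaveOn_dysonMap_fixed (ha : ∀ i j, 0 ≤ a i j) {U : ℝ → κ → ℝ}
    (hpos : ∀ x, 0 < x → ∀ j, 0 < U x j) (hfix : ∀ x, 0 < x → dysonMap a x (U x) = U x)
    (j : κ) : ConcaveOn ℝ (Set.Ioi 0) fun x => U x j := by
  refine ⟨convex_Ioi 0, fun x hx y hy s t hs ht hst => ?_⟩
  have hxy : 0 < s • x + t • y := convex_Ioi (0 : ℝ) hx hy hs ht hst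
  have hUx : 0 ≤ U x := fun k => (hpos x hx k).le
  have hUy : 0 ≤ U y := fun k => (hpos y hy k).le
  -- By joint concavity of the map, the combination of the two solutions is a subsolution at the
  -- averaged parameter.
  refine le_of_le_dysonMap_of_dysonMap_le (v := s • U x + t • U y) ha hxy (hpos _ hxy)
    (fun k => ?_) (fun k => ?_) (hfix _ hxy).le j
  · exact convex_Ioi (0 : ℝ) (hpos x hx k) (hpos y hy k) hs ht hst
  · have h := convexComb_dysonMap_le ha hx hy hUx hUy hs ht hst k
    rwa [hfix x hx, hfix y hy] at h

end Dyson

/-! ### The deterministic risk as a tangent to a concave function -/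

section DetRisk

variable {n p : ℕ} {Γ : Matrix (Fin n) (Fin p) ℝ} {l : ℝ}

/-- The normalised profile `Γ / n`. -/
def normProfile (Γ : Matrix (Fin n) (Fin p) ℝ) (i : Fin n) (j : Fin p) : ℝ := Γ i j / n

theorem normProfile_nonneg (hΓ : ∀ i j, 0 ≤ Γ i j) (i : Fin n) (j : Fin p) :
    0 ≤ normProfile Γ i j := div_nonneg (hΓ i j) n.cast_nonneg

/-- The Dyson system at `-l` is the fixed point equation for `u = l T`. -/
theorem isDyson_neg_iff (hΓ : ∀ i j, 0 ≤ Γ i j) (hl : 0 < l) (s : (Fin p → ℝ) × (Fin n → ℝ)) :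
    IsDyson Γ (-l) s ↔ (∀ j, 0 < s.1 j) ∧
      dysonMap (normProfile Γ) l (l • s.1) = l • s.1 ∧
      s.2 = fun i => (dysonDen (normProfile Γ) l (l • s.1) i)⁻¹ := by
  -- The second family of equations determines the companion unknowns as reciprocals of the
  -- denominators at `l • s.1`.
  have hR : ∀ i, -1 / (-l * (1 + (1 / (n : ℝ)) *
      Matrix.trace (Matrix.diagonal (fun j => Γ i j) * Matrix.diagonal s.1)))
      = (dysonDen (normProfile Γ) l (l • s.1) i)⁻¹ := fun i => by
    rw [Matrix.diagonal_mul_diagonal, Matrix.trace_diagonal, neg_mul, neg_div_neg_eq, one_div]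
    congr 1
    simp only [dysonDen, normProfile, Pi.smul_apply, smul_eq_mul, mul_add, mul_one, Finset.mul_sum]
    congr 1
    exact Finset.sum_congr rfl fun j _ => by ring
  have hLft : s.2 = (fun i => (dysonDen (normProfile Γ) l (l • s.1) i)⁻¹) → ∀ j,
      (s.1 j = -1 / (-l * (1 + (1 / (n : ℝ)) *
        Matrix.trace (Matrix.diagonal (fun i => Γ i j) * Matrix.diagonal s.2)))
      ↔ dysonMap (normProfile Γ) l (l • s.1) j = (l • s.1) j) := fun h2 j => by
    have : (1 / (n : ℝ)) * Matrix.trace (Matrix.diagonal (fun i => Γ i j) * Matrix.diagonal s.2)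
        = ∑ i, normProfile Γ i j / dysonDen (normProfile Γ) l (l • s.1) i := by
      rw [Matrix.diagonal_mul_diagonal, Matrix.trace_diagonal, h2, Finset.mul_sum]
      exact Finset.sum_congr rfl fun i _ => by rw [normProfile]; ring
    rw [this, neg_mul, neg_div_neg_eq, one_div, mul_inv, Pi.smul_apply, smul_eq_mul, dysonMap,
      eq_inv_mul_iff_mul_eq₀ hl.ne', eq_comm]
  constructor
  · intro h
    have h2 : s.2 = fun i => (dysonDen (normProfile Γ) l (l • s.1) i)⁻¹ :=
      funext fun i => (h.eq_right i).trans (hR i)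
    exact ⟨h.pos_left, funext fun j => (hLft h2 j).1 (h.eq_left j), h2⟩
  · rintro ⟨h1, h2, h3⟩
    have h0 : 0 ≤ l • s.1 := smul_nonneg hl.le fun j => (h1 j).le
    refine ⟨h1, fun i => ?_, fun j => (hLft h3 j).2 (congrFun h2 j), fun i => ?_⟩
    · rw [h3]
      exact inv_pos.2 (dysonDen_pos (normProfile_nonneg hΓ) hl h0 i)
    · rw [hR, h3]

theorem existsUnique_isDyson (hΓ : ∀ i j, 0 ≤ Γ i j) (hl : 0 < l) : ∃! s, IsDyson Γ (-l) s := by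
  obtain ⟨u, hu, hfix⟩ := exists_dysonMap_fixed (normProfile_nonneg hΓ) hl
  have hlu : l • l⁻¹ • u = u := smul_inv_smul₀ hl.ne' u
  refine ⟨(l⁻¹ • u, fun i => (dysonDen (normProfile Γ) l u i)⁻¹), ?_, ?_⟩
  · refine (isDyson_neg_iff hΓ hl _).2 ⟨fun j => mul_pos (inv_pos.2 hl) (hu j), ?_, ?_⟩ <;>
      simp only [hlu, hfix]
  · intro s hs
    obtain ⟨h1, h2, h3⟩ := (isDyson_neg_iff hΓ hl s).1 hs
    have h : l • s.1 = u := dysonMap_fixed_unique (normProfile_nonneg hΓ) hl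
      (fun j => mul_pos hl (h1 j)) hu h2 hfix
    refine Prod.ext ?_ ?_
    · rw [← h, inv_smul_smul₀ hl.ne']
    · rw [h3, h]

/-- `λ T(-λ)`, the solution of the Dyson system in its concave normalisation. -/
def scaledDysonT (Γ : Matrix (Fin n) (Fin p) ℝ) (l : ℝ) : Fin p → ℝ := l • dysonT Γ (-l)

/-- Existence makes the choice in `dysonT` meaningful: it is the positive solution and no default
value. -/
theorem isDyson_epsilon (hΓ : ∀ i j, 0 ≤ Γ i j) (hl : 0 < l) :
    IsDyson Γ (-l) (Classical.epsilon (IsDyson Γ (-l))) :=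
  Classical.epsilon_spec (existsUnique_isDyson hΓ hl).exists

theorem scaledDysonT_pos (hΓ : ∀ i j, 0 ≤ Γ i j) (l : ℝ) (hl : 0 < l) (j : Fin p) :
    0 < scaledDysonT Γ l j :=
  mul_pos hl ((isDyson_epsilon hΓ hl).pos_left j)

theorem dysonMap_scaledDysonT (hΓ : ∀ i j, 0 ≤ Γ i j) (l : ℝ) (hl : 0 < l) :
    dysonMap (normProfile Γ) l (scaledDysonT Γ l) = scaledDysonT Γ l :=
  ((isDyson_neg_iff hΓ hl _).1 (isDyson_epsilon hΓ hl)).2.1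

theorem differentiableAt_scaledDysonT (hΓ : ∀ i j, 0 ≤ Γ i j) (hl : 0 < l) (j : Fin p) :
    DifferentiableAt ℝ (fun x => scaledDysonT Γ x j) l :=
  differentiableAt_pi.1 (differentiableAt_dysonMap_fixed (normProfile_nonneg hΓ)
    (scaledDysonT_pos hΓ) (dysonMap_scaledDysonT hΓ) hl) j

theorem hasDerivAt_dysonT (hΓ : ∀ i j, 0 ≤ Γ i j) (hl : 0 < l) (j : Fin p) :
    HasDerivAt (fun y => dysonT Γ y j)
      ((scaledDysonT Γ l j / l - deriv (fun x => scaledDysonT Γ x j) l) / l) (-l) := by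
  have h1 : HasDerivAt (fun x => scaledDysonT Γ x j) (deriv (fun x => scaledDysonT Γ x j) l)
      (-(-l)) := by
    rw [neg_neg]; exact (differentiableAt_scaledDysonT hΓ hl j).hasDerivAt
  have h2 := (h1.comp (-l) (hasDerivAt_neg (-l))).fun_div (hasDerivAt_neg (-l))
    (by rw [neg_neg]; exact hl.ne')
  -- `T(y) = u(-y) / (-y)` holds for `y < 0`, hence near `-l`, which is enough for the derivative.
  have h3 : (fun y => dysonT Γ y j) =ᶠ[nhds (-l)]
      fun y => ((fun x => scaledDysonT Γ x j) ∘ Neg.neg) y / -y := by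
    filter_upwards [gt_mem_nhds (neg_lt_zero.2 hl)] with y hy
    simp only [Function.comp_apply, scaledDysonT, neg_neg, Pi.smul_apply, smul_eq_mul]
    exact (mul_div_cancel_left₀ _ (neg_ne_zero.2 hy.ne)).symm
  refine (h2.congr_of_eventuallyEq h3).congr_deriv ?_
  simp only [Function.comp_apply, neg_neg]
  field_simp
  ring

theorem _root_.ConcaveOn.le_tangent {S : Set ℝ} {f : ℝ → ℝ} (hf : ConcaveOn ℝ S f) {x y f' : ℝ}
    (hx : x ∈ S) (hy : y ∈ S) (hf' : HasDerivAt f f' x) : f y ≤ f x + (y - x) * f' := by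
  rcases lt_trichotomy x y with h | rfl | h
  · have := hf.slope_le_of_hasDerivAt hx hy h hf'
    rw [slope_def_field, div_le_iff₀ (sub_pos.2 h)] at this
    linarith
  · simp
  · have := hf.le_slope_of_hasDerivAt hy hx h hf'
    rw [slope_def_field, le_div_iff₀ (sub_pos.2 h)] at this
    linarith

/-- The deterministic risk at `l` is the value at `optLambda` of the tangent at `l` to a concave
function. -/
theorem detRisk_eq (hn : 0 < n) (hp : 0 < p) {α σ : ℝ} (hα : 0 < α)
    (U : Matrix (Fin n) (Fin p) ℝ) (g : Fin p → ℝ) (hl : 0 < l) :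
    detRisk U g α σ l = σ ^ 2 + α ^ 2 / p * ∑ j, g j ^ 2 * (scaledDysonT (varProfile U) l j +
      (optLambda n p α σ - l) * deriv (fun x => scaledDysonT (varProfile U) x j) l) := by
  have hΓ : ∀ i j, 0 ≤ varProfile U i j := fun i j => sq_nonneg (U i j)
  have hn' : (n : ℝ) ≠ 0 := by positivity
  have hp' : (p : ℝ) ≠ 0 := by positivity
  have hT : ∀ j, dysonT (varProfile U) (-l) j = scaledDysonT (varProfile U) l j / l := fun j =>
    (mul_div_cancel_left₀ _ hl.ne').symm
  have hT' : ∀ j, dysonT' (varProfile U) (-l) j = _ := fun j => (hasDerivAt_dysonT hΓ hl j).deriv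
  simp only [detRisk, testCov, Matrix.diagonal_mul_diagonal, Matrix.trace_diagonal, hT, hT',
    add_assoc, Finset.mul_sum, ← Finset.sum_add_distrib]
  congr 1
  refine Finset.sum_congr rfl fun j _ => ?_
  -- Since `T' = (u/l - u')/l` and `(α²/p) λ_* = σ²/n`, the terms in `σ² u / (n l)` cancel and
  -- `(α²/p)(u + (λ_* - l) u')` remains.
  unfold optLambda
  field_simp
  ring

theorem optLambda_pos (hn : 0 < n) (hp : 0 < p) {α σ : ℝ} (hα : 0 < α) (hσ : 0 < σ) :
    0 < optLambda n p α σ := by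
  unfold optLambda; positivity

theorem detRisk_optLambda_le (hn : 0 < n) (hp : 0 < p) {α σ : ℝ} (hα : 0 < α) (hσ : 0 < σ)
    (U : Matrix (Fin n) (Fin p) ℝ) (g : Fin p → ℝ) (hl : 0 < l) :
    detRisk U g α σ (optLambda n p α σ) ≤ detRisk U g α σ l := by
  have hΓ : ∀ i j, 0 ≤ varProfile U i j := fun i j => sq_nonneg (U i j)
  have ho := optLambda_pos hn hp hα hσ
  rw [detRisk_eq hn hp hα U g ho, detRisk_eq hn hp hα U g hl]
  refine add_le_add_right (mul_le_mul_of_nonneg_left (Finset.sum_le_sum fun j _ =>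
    mul_le_mul_of_nonneg_left ?_ (sq_nonneg _)) (by positivity)) _
  rw [sub_self, zero_mul, add_zero]
  exact (concaveOn_dysonMap_fixed (normProfile_nonneg hΓ) (scaledDysonT_pos hΓ)
    (dysonMap_scaledDysonT hΓ) j).le_tangent hl ho
      (differentiableAt_scaledDysonT hΓ hl j).hasDerivAt

end DetRisk

/-! ### Independence, products and conditioning -/

section Independence

variable {Ω α β γ : Type*} [MeasurableSpace Ω] {P : Measure Ω}
  [MeasurableSpace α] [MeasurableSpace β] [MeasurableSpace γ]

/-- Independence lets the second moment of the product factor, so no fourth moments are needed. -/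
theorem _root_.ProbabilityTheory.IndepFun.memLp_two_mul {X Y : Ω → ℝ} (h : IndepFun X Y P)
    (hX : MemLp X 2 P) (hY : MemLp Y 2 P) : MemLp (fun ω => X ω * Y ω) 2 P := by
  refine (memLp_two_iff_integrable_sq (hX.aestronglyMeasurable.mul hY.aestronglyMeasurable)).2 ?_
  have h2 : IndepFun (fun ω => X ω ^ 2) (fun ω => Y ω ^ 2) P :=
    h.comp (measurable_id.pow_const 2) (measurable_id.pow_const 2)
  exact (h2.integrable_mul hX.integrable_sq hY.integrable_sq).congr
    (ae_of_all _ fun ω => (mul_pow _ _ _).symm)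

variable [IsProbabilityMeasure P]

theorem _root_.ProbabilityTheory.IndepFun.assoc {A : Ω → α} {B : Ω → β} {C : Ω → γ}
    (hA : Measurable A) (hB : Measurable B) (hC : Measurable C)
    (h : IndepFun A (fun ω => (B ω, C ω)) P) (hBC : IndepFun B C P) :
    IndepFun (fun ω => (A ω, B ω)) C P := by
  have hAB : IndepFun A B P := h.comp measurable_id measurable_fst
  have : IsProbabilityMeasure (P.map A) := Measure.isProbabilityMeasure_map hA.aemeasurable
  have : IsProbabilityMeasure (P.map B) := Measure.isProbabilityMeasure_map hB.aemeasurable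
  have : IsProbabilityMeasure (P.map C) := Measure.isProbabilityMeasure_map hC.aemeasurable
  rw [indepFun_iff_map_prod_eq_prod_map_map (by fun_prop) hC.aemeasurable,
    hAB.map_prod_eq_prod_map_map hA.aemeasurable hB.aemeasurable]
  have h1 := h.map_prod_eq_prod_map_map hA.aemeasurable (by fun_prop)
  rw [hBC.map_prod_eq_prod_map_map hB.aemeasurable hC.aemeasurable] at h1
  rw [← ((measurePreserving_prodAssoc (P.map A) (P.map B) (P.map C)).symm _).map_eq, ← h1,
    Measure.map_map (MeasurableEquiv.measurable _) (by fun_prop)]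
  rfl

/-- Conditioning on a variable independent of the rest amounts to integrating out the rest. -/
theorem condExp_comap_ae_eq_integral_of_indepFun [StandardBorelSpace β] [Nonempty β]
    {X : Ω → α} {W : Ω → β} {f : α × β → ℝ} (hX : Measurable X) (hW : Measurable W)
    (hXW : IndepFun X W P) (hf : Measurable f) (hfi : Integrable (fun ω => f (X ω, W ω)) P) :
    (fun ω => ∫ ω', f (X ω, W ω') ∂P)
      =ᵐ[P] P[fun ω => f (X ω, W ω) | MeasurableSpace.comap X inferInstance] := by
  have h1 := condExp_prod_ae_eq_integral_condDistrib hX hW.aemeasurable hf.stronglyMeasurable hfi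
  have : IsProbabilityMeasure (P.map W) := Measure.isProbabilityMeasure_map hW.aemeasurable
  have : IsProbabilityMeasure (P.map X) := Measure.isProbabilityMeasure_map hX.aemeasurable
  -- By independence the conditional law of `W` given `X` is the constant kernel with value the law
  -- of `W`.
  have h2 : condDistrib W X P =ᵐ[P.map X] Kernel.const α (P.map W) :=
    condDistrib_ae_eq_of_measure_eq_compProd X hW.aemeasurable (by
      rw [Measure.compProd_const,
        hXW.map_prod_eq_prod_map_map hX.aemeasurable hW.aemeasurable])
  filter_upwards [h1, ae_of_ae_map hX.aemeasurable h2] with ω h3 h4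
  rw [h3, h4, Kernel.const_apply, integral_map hW.aemeasurable
    (by exact (hf.comp measurable_prodMk_left).aestronglyMeasurable)]

end Independence

/-! ### Optimal linear prediction by orthogonality -/

section LinearEstimator

variable {Ω : Type*} [MeasurableSpace Ω] {P : Measure Ω} {n p : ℕ}
  {b : Ω → Fin p → ℝ} {e : Ω → Fin n → ℝ} {xt : Ω → Fin p → ℝ} {et : Ω → ℝ}

theorem _root_.MeasureTheory.MemLp.integrable_fun_mul_two {X Y : Ω → ℝ} (hX : MemLp X 2 P)
    (hY : MemLp Y 2 P) : Integrable (fun ω => X ω * Y ω) P := hX.integrable_mul hY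

theorem memLp_mulVec {m k : ℕ} {v : Ω → Fin k → ℝ} (M : Matrix (Fin m) (Fin k) ℝ)
    (hv : ∀ j, MemLp (fun ω => v ω j) 2 P) (i : Fin m) :
    MemLp (fun ω => (M *ᵥ v ω) i) 2 P := by
  simp only [Matrix.mulVec, dotProduct]
  exact memLp_finsetSum _ fun j _ => (hv j).const_mul (M i j)

theorem memLp_response (A : Matrix (Fin n) (Fin p) ℝ) (hb : ∀ j, MemLp (fun ω => b ω j) 2 P)
    (he : ∀ i, MemLp (fun ω => e ω i) 2 P) (i : Fin n) :
    MemLp (fun ω => response A (b ω) (e ω) i) 2 P :=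
  (memLp_mulVec A hb i).add (he i)

theorem integral_mulVec_mul {m k : ℕ} {v : Ω → Fin k → ℝ} {w : Ω → ℝ}
    (M : Matrix (Fin m) (Fin k) ℝ) (hv : ∀ j, MemLp (fun ω => v ω j) 2 P) (hw : MemLp w 2 P)
    (i : Fin m) : ∫ ω, (M *ᵥ v ω) i * w ω ∂P = (M *ᵥ fun j => ∫ ω, v ω j * w ω ∂P) i := by
  simp only [Matrix.mulVec, dotProduct, Finset.sum_mul]
  rw [integral_finsetSum _ fun j _ => by
    simpa only [mul_assoc] using! ((hv j).integrable_fun_mul_two hw).const_mul (M i j)]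
  simp only [mul_assoc, integral_const_mul]

variable {c s : ℝ}

/-- The covariance of coefficients and responses. -/
theorem integral_coeff_mul_response (A : Matrix (Fin n) (Fin p) ℝ)
    (hbe : IndepFun b e P)
    (hb : ∀ j, MemLp (fun ω => b ω j) 2 P) (he : ∀ i, MemLp (fun ω => e ω i) 2 P)
    (hb0 : ∀ j, ∫ ω, b ω j ∂P = 0)
    (hbc : ∀ j j', ∫ ω, b ω j * b ω j' ∂P = if j = j' then c else 0) (k : Fin p) (i : Fin n) :
    ∫ ω, b ω k * response A (b ω) (e ω) i ∂P = c * A i k := by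
  have h1 : ∫ ω, b ω k * e ω i ∂P = 0 := by
    have h : IndepFun (fun ω => b ω k) (fun ω => e ω i) P :=
      hbe.comp (measurable_pi_apply k) (measurable_pi_apply i)
    rw [h.integral_fun_mul_eq_mul_integral (hb k).1 (he i).1, hb0 k, zero_mul]
  simp only [response, Pi.add_apply, mul_add]
  rw [integral_add ((hb k).integrable_fun_mul_two (memLp_mulVec A hb i)) ((hb k).integrable_fun_mul_two (he i)),
    h1, add_zero]
  simp only [mul_comm (b _ k)]
  rw [integral_mulVec_mul A hb (hb k)]
  simp [Matrix.mulVec, dotProduct, hbc, mul_comm]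

/-- The covariance of noise and responses. -/
theorem integral_noise_mul_response (A : Matrix (Fin n) (Fin p) ℝ)
    (hbe : IndepFun b e P)
    (hb : ∀ j, MemLp (fun ω => b ω j) 2 P) (he : ∀ i, MemLp (fun ω => e ω i) 2 P)
    (hb0 : ∀ j, ∫ ω, b ω j ∂P = 0)
    (hec : ∀ i i', ∫ ω, e ω i * e ω i' ∂P = if i = i' then s else 0) (m i : Fin n) :
    ∫ ω, e ω m * response A (b ω) (e ω) i ∂P = if m = i then s else 0 := by
  have h1 : ∀ k, ∫ ω, b ω k * e ω m ∂P = 0 := fun k => by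
    have h : IndepFun (fun ω => b ω k) (fun ω => e ω m) P :=
      hbe.comp (measurable_pi_apply k) (measurable_pi_apply m)
    rw [h.integral_fun_mul_eq_mul_integral (hb k).1 (he m).1, hb0 k, zero_mul]
  simp only [response, Pi.add_apply, mul_add]
  rw [integral_add ((he m).integrable_fun_mul_two (memLp_mulVec A hb i)) ((he m).integrable_fun_mul_two (he i)),
    hec]
  simp only [mul_comm (e _ m)]
  rw [integral_mulVec_mul A hb (he m)]
  simp [Matrix.mulVec, dotProduct, h1]

/-- The residual of the best linear estimator is uncorrelated with the responses. -/
theorem integral_residual_mul_response (A : Matrix (Fin n) (Fin p) ℝ)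
    (hbe : IndepFun b e P)
    (hb : ∀ j, MemLp (fun ω => b ω j) 2 P) (he : ∀ i, MemLp (fun ω => e ω i) 2 P)
    (hb0 : ∀ j, ∫ ω, b ω j ∂P = 0)
    (hbc : ∀ j j', ∫ ω, b ω j * b ω j' ∂P = if j = j' then c else 0)
    (hec : ∀ i i', ∫ ω, e ω i * e ω i' ∂P = if i = i' then s else 0)
    {K : Matrix (Fin p) (Fin n) ℝ} (hK : K * (c • (A * Aᵀ) + s • 1) = c • Aᵀ)
    (k : Fin p) (i : Fin n) :
    ∫ ω, (b ω - K *ᵥ response A (b ω) (e ω)) k * response A (b ω) (e ω) i ∂P = 0 := by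
  have hY := memLp_response A hb he
  have hYY : ∀ m, ∫ ω, response A (b ω) (e ω) m * response A (b ω) (e ω) i ∂P
      = (c • (A * Aᵀ) + s • (1 : Matrix (Fin n) (Fin n) ℝ)) m i := fun m => by
    have h : ∀ ω, response A (b ω) (e ω) m * response A (b ω) (e ω) i
        = (A *ᵥ b ω) m * response A (b ω) (e ω) i + e ω m * response A (b ω) (e ω) i :=
      fun ω => add_mul _ _ _
    simp only [h]
    rw [integral_add ((memLp_mulVec A hb m).integrable_fun_mul_two (hY i)) ((he m).integrable_fun_mul_two (hY i)),
      integral_mulVec_mul A hb (hY i), integral_noise_mul_response A hbe hb he hb0 hec]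
    simp only [integral_coeff_mul_response A hbe hb he hb0 hbc, Matrix.add_apply,
      Matrix.smul_apply, Matrix.one_apply, Matrix.mul_apply, Matrix.transpose_apply,
      Matrix.mulVec, dotProduct, smul_eq_mul, mul_ite, mul_one, mul_zero, Finset.mul_sum]
    congr 1
    exact Finset.sum_congr rfl fun j _ => by ring
  simp only [Pi.sub_apply, sub_mul]
  rw [integral_sub ((hb k).integrable_fun_mul_two (hY i)) ((memLp_mulVec K hY k).integrable_fun_mul_two (hY i)),
    integral_coeff_mul_response A hbe hb he hb0 hbc, integral_mulVec_mul K hY (hY i)]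
  simp only [hYY]
  -- `hK` is the normal equation `K Cov(Y) = Cov(b, Y)`, read entrywise.
  have h := congrFun (congrFun hK k) i
  rw [Matrix.mul_apply] at h
  rw [Matrix.mulVec, dotProduct, h]
  simp

theorem memLp_dotProduct_of_indepFun {k : ℕ} {x v : Ω → Fin k → ℝ} (h : IndepFun x v P)
    (hx : ∀ j, MemLp (fun ω => x ω j) 2 P) (hv : ∀ j, MemLp (fun ω => v ω j) 2 P) :
    MemLp (fun ω => x ω ⬝ᵥ v ω) 2 P := by
  simp only [dotProduct]
  exact memLp_finsetSum _ fun j _ => IndepFun.memLp_two_mul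
    (h.comp (measurable_pi_apply j) (measurable_pi_apply j)) (hx j) (hv j)

theorem measurable_response (A : Matrix (Fin n) (Fin p) ℝ) :
    Measurable fun q : (Fin p → ℝ) × (Fin n → ℝ) => response A q.1 q.2 := by
  unfold response Matrix.mulVec dotProduct
  fun_prop

theorem measurable_mulVec {m k : ℕ} (M : Matrix (Fin m) (Fin k) ℝ) :
    Measurable fun v : Fin k → ℝ => M *ᵥ v := by
  unfold Matrix.mulVec dotProduct
  fun_prop

variable [IsProbabilityMeasure P]

/-- The best linear estimator of the coefficients has the least squared prediction error among
all linear estimators. -/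
theorem integral_sq_error_le (A : Matrix (Fin n) (Fin p) ℝ)
    (hT : IndepFun (fun ω => (xt ω, et ω)) (fun ω => (b ω, e ω)) P) (hbe : IndepFun b e P)
    (hx : ∀ j, MemLp (fun ω => xt ω j) 2 P) (het : MemLp et 2 P)
    (hb : ∀ j, MemLp (fun ω => b ω j) 2 P) (he : ∀ i, MemLp (fun ω => e ω i) 2 P)
    (hb0 : ∀ j, ∫ ω, b ω j ∂P = 0) (he0 : ∀ i, ∫ ω, e ω i ∂P = 0)
    (hbc : ∀ j j', ∫ ω, b ω j * b ω j' ∂P = if j = j' then c else 0)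
    (hec : ∀ i i', ∫ ω, e ω i * e ω i' ∂P = if i = i' then s else 0)
    {K : Matrix (Fin p) (Fin n) ℝ} (hK : K * (c • (A * Aᵀ) + s • 1) = c • Aᵀ)
    (L : Matrix (Fin p) (Fin n) ℝ) :
    ∫ ω, (xt ω ⬝ᵥ b ω + et ω - xt ω ⬝ᵥ (K *ᵥ response A (b ω) (e ω))) ^ 2 ∂P
      ≤ ∫ ω, (xt ω ⬝ᵥ b ω + et ω - xt ω ⬝ᵥ (L *ᵥ response A (b ω) (e ω))) ^ 2 ∂P := by
  set Y : Ω → Fin n → ℝ := fun ω => response A (b ω) (e ω) with hYdef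
  set R : Ω → Fin p → ℝ := fun ω => b ω - K *ᵥ Y ω with hRdef
  have hY : ∀ i, MemLp (fun ω => Y ω i) 2 P := memLp_response A hb he
  have hR : ∀ k, MemLp (fun ω => R ω k) 2 P := fun k => (hb k).sub (memLp_mulVec K hY k)
  have hxY : IndepFun xt Y P := hT.comp measurable_fst (measurable_response A)
  have hxR : IndepFun xt R P := hT.comp measurable_fst
    (measurable_fst.sub ((measurable_mulVec K).comp (measurable_response A)))
  have hxjYi : ∀ j i, MemLp (fun ω => xt ω j * Y ω i) 2 P := fun j i =>
    IndepFun.memLp_two_mul (hxY.comp (measurable_pi_apply j) (measurable_pi_apply i)) (hx j) (hY i)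
  have hxkRk : ∀ k, MemLp (fun ω => xt ω k * R ω k) 2 P := fun k =>
    IndepFun.memLp_two_mul (hxR.comp (measurable_pi_apply k) (measurable_pi_apply k)) (hx k) (hR k)
  have hY0 : ∀ i, ∫ ω, Y ω i ∂P = 0 := fun i => by
    have h1 : ∫ ω, (A *ᵥ b ω) i ∂P = 0 := by
      simp only [Matrix.mulVec, dotProduct]
      rw [integral_finsetSum _ fun j _ => ((hb j).integrable one_le_two).const_mul _]
      simp [integral_const_mul, hb0]
    have h2 := integral_add ((memLp_mulVec A hb i).integrable one_le_two)
      ((he i).integrable one_le_two)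
    rw [h1, he0 i, add_zero] at h2
    exact h2
  -- `E` is the prediction error of `K`, and the error of `L` is `E + D`. It remains to show that
  -- `E` and `D` are orthogonal in `L²`.
  set E : Ω → ℝ := fun ω => xt ω ⬝ᵥ R ω + et ω with hEdef
  set D : Ω → ℝ := fun ω => xt ω ⬝ᵥ ((K - L) *ᵥ Y ω) with hDdef
  have hE : MemLp E 2 P := (memLp_dotProduct_of_indepFun hxR hx hR).add het
  have hD : MemLp D 2 P := memLp_dotProduct_of_indepFun
    (hxY.comp measurable_id (measurable_mulVec (K - L))) hx (memLp_mulVec _ hY)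
  -- The part of `E` coming from `R` vanishes because `R` is uncorrelated with `Y`; the part coming
  -- from the test noise vanishes because `Y` is centred and independent of the test pair.
  have hterm : ∀ j i, ∫ ω, E ω * (xt ω j * Y ω i) ∂P = 0 := fun j i => by
    have h1 : ∀ k, ∫ ω, xt ω k * R ω k * (xt ω j * Y ω i) ∂P = 0 := fun k => by
      have hind : IndepFun (fun ω => xt ω k * xt ω j) (fun ω => R ω k * Y ω i) P := by
        refine hT.comp (φ := fun q => q.1 k * q.1 j)
          (ψ := fun q => (q.1 - K *ᵥ response A q.1 q.2) k * response A q.1 q.2 i) ?_ ?_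
        · fun_prop
        · exact (((measurable_pi_apply k).comp (measurable_fst.sub
            ((measurable_mulVec K).comp (measurable_response A)))).mul
            ((measurable_pi_apply i).comp (measurable_response A)))
      calc ∫ ω, xt ω k * R ω k * (xt ω j * Y ω i) ∂P
          = ∫ ω, (xt ω k * xt ω j) * (R ω k * Y ω i) ∂P :=
            integral_congr_ae (ae_of_all _ fun ω => by ring)
        _ = 0 := by
            rw [hind.integral_fun_mul_eq_mul_integral ((hx k).1.mul (hx j).1)
              ((hR k).1.mul (hY i).1),
              integral_residual_mul_response A hbe hb he hb0 hbc hec hK, mul_zero]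
    have h2 : ∫ ω, et ω * (xt ω j * Y ω i) ∂P = 0 := by
      have hind : IndepFun (fun ω => et ω * xt ω j) (fun ω => Y ω i) P := by
        refine hT.comp (φ := fun q => q.2 * q.1 j) (ψ := fun q => response A q.1 q.2 i) ?_ ?_
        · fun_prop
        · exact (measurable_pi_apply i).comp (measurable_response A)
      simp only [← mul_assoc]
      rw [hind.integral_fun_mul_eq_mul_integral (het.1.mul (hx j).1) (hY i).1, hY0, mul_zero]
    simp only [hEdef, dotProduct, add_mul, Finset.sum_mul]
    rw [integral_add (integrable_finsetSum _ fun k _ => (hxkRk k).integrable_fun_mul_two (hxjYi j i))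
      (het.integrable_fun_mul_two (hxjYi j i)),
      integral_finsetSum _ fun k _ => (hxkRk k).integrable_fun_mul_two (hxjYi j i)]
    simp [h1, h2]
  have hcross : ∫ ω, E ω * D ω ∂P = 0 := by
    have h : ∀ ω, E ω * D ω = ∑ j, ∑ i, (K - L) j i * (E ω * (xt ω j * Y ω i)) := fun ω => by
      simp only [hDdef, dotProduct, Matrix.mulVec, Finset.mul_sum]
      exact Finset.sum_congr rfl fun j _ => Finset.sum_congr rfl fun i _ => by ring
    have hint : ∀ j i, Integrable (fun ω => (K - L) j i * (E ω * (xt ω j * Y ω i))) P :=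
      fun j i => (hE.integrable_fun_mul_two (hxjYi j i)).const_mul _
    simp only [h]
    rw [integral_finsetSum _ fun j _ => integrable_finsetSum _ fun i _ => hint j i]
    refine Finset.sum_eq_zero fun j _ => ?_
    rw [integral_finsetSum _ fun i _ => hint j i]
    exact Finset.sum_eq_zero fun i _ => by rw [integral_const_mul, hterm, mul_zero]
  have hKe : ∀ ω, (xt ω ⬝ᵥ b ω + et ω - xt ω ⬝ᵥ (K *ᵥ Y ω)) ^ 2 = E ω ^ 2 := fun ω => by
    simp only [hEdef, hRdef, dotProduct_sub]; ring
  have hLe : ∀ ω, (xt ω ⬝ᵥ b ω + et ω - xt ω ⬝ᵥ (L *ᵥ Y ω)) ^ 2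
      = E ω ^ 2 + (2 * (E ω * D ω) + D ω ^ 2) := fun ω => by
    simp only [hEdef, hRdef, hDdef, dotProduct_sub, Matrix.sub_mulVec]; ring
  refine (integral_congr_ae (ae_of_all _ hKe)).trans_le
    (le_of_le_of_eq ?_ (integral_congr_ae (ae_of_all _ hLe)).symm)
  have hi := (hE.integrable_fun_mul_two hD).const_mul 2
  have hi' : Integrable (fun ω => 2 * (E ω * D ω) + D ω ^ 2) P := hi.add hD.integrable_sq
  rw [integral_add hE.integrable_sq hi', integral_add hi hD.integrable_sq,
    integral_const_mul, hcross]
  have : 0 ≤ ∫ ω, D ω ^ 2 ∂P := integral_nonneg fun ω => sq_nonneg _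
  linarith

end LinearEstimator

/-! ### Ridge regression: optimality, bounds, measurability -/

section Ridge

variable {n p : ℕ}

theorem ridge_eq_mulVec (l : ℝ) (X : Matrix (Fin n) (Fin p) ℝ) (Y : Fin n → ℝ) :
    ridge l X Y
      = ((Xᵀ * X + ((n : ℝ) * l) • (1 : Matrix (Fin p) (Fin p) ℝ))⁻¹ * Xᵀ) *ᵥ Y := by
  rw [ridge, Matrix.mulVec_mulVec]

/-- At the optimal regularisation, ridge regression is the best linear estimator. -/
theorem ridge_optLambda_normal_eq (hn : 0 < n) (hp : 0 < p) {α σ : ℝ} (hα : 0 < α) (hσ : 0 < σ)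
    (X : Matrix (Fin n) (Fin p) ℝ) :
    ((Xᵀ * X + ((n : ℝ) * optLambda n p α σ) • (1 : Matrix (Fin p) (Fin p) ℝ))⁻¹ * Xᵀ)
      * ((α ^ 2 / p) • (X * Xᵀ) + σ ^ 2 • 1) = (α ^ 2 / p) • Xᵀ := by
  have hn' : (n : ℝ) ≠ 0 := by positivity
  have hp' : (p : ℝ) ≠ 0 := by positivity
  have hd := (Matrix.isUnit_iff_isUnit_det _).1
    (ridge_posDef hn (optLambda_pos hn hp hα hσ) X).isUnit
  -- This identity characterises `λ_*`. It turns the normal equation into the push-through identity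
  -- `Xᵀ (X Xᵀ + c I) = (Xᵀ X + c I) Xᵀ`.
  have hs : σ ^ 2 = (α ^ 2 / p) * ((n : ℝ) * optLambda n p α σ) := by
    unfold optLambda; field_simp
  have h : Xᵀ * ((α ^ 2 / p) • (X * Xᵀ) + σ ^ 2 • (1 : Matrix (Fin n) (Fin n) ℝ))
      = (Xᵀ * X + ((n : ℝ) * optLambda n p α σ) • (1 : Matrix (Fin p) (Fin p) ℝ))
        * ((α ^ 2 / p) • Xᵀ) := by
    rw [hs, mul_smul, ← smul_add, Matrix.mul_smul, Matrix.mul_smul, Matrix.mul_add,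
      Matrix.add_mul, Matrix.mul_smul, Matrix.smul_mul, Matrix.mul_one, Matrix.one_mul,
      Matrix.mul_assoc]
  rw [Matrix.mul_assoc, h, ← Matrix.mul_assoc, Matrix.nonsing_inv_mul _ hd, Matrix.one_mul]

/-- The ridge estimator is controlled by the coefficients and the noise, uniformly in `X`. -/
theorem ridge_dotProduct_self_le (hn : 0 < n) {l : ℝ} (hl : 0 < l)
    (X : Matrix (Fin n) (Fin p) ℝ) (b : Fin p → ℝ) (e : Fin n → ℝ) :
    ridge l X (response X b e) ⬝ᵥ ridge l X (response X b e)
      ≤ b ⬝ᵥ b + (n * l : ℝ)⁻¹ * (e ⬝ᵥ e) := by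
  have hn' : (0 : ℝ) < n := by exact_mod_cast hn
  -- The true coefficients `b` serve as competitor in the ridge objective; their residual is exactly
  -- the noise `e`.
  have hmin : ridgeObjective l X (response X b e) (ridge l X (response X b e))
      ≤ ridgeObjective l X (response X b e) b := by
    by_cases h : b = ridge l X (response X b e)
    · rw [← h]
    · exact (ridge_unique_min hn hl X _ b h).le
  have hb : response X b e - X *ᵥ b = e := by simp [response]
  set r := ridge l X (response X b e)
  unfold ridgeObjective at hmin
  rw [hb] at hmin
  have h0 : 0 ≤ 1 / (n : ℝ) * ((response X b e - X *ᵥ r) ⬝ᵥ (response X b e - X *ᵥ r)) :=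
    mul_nonneg (by positivity) (Finset.sum_nonneg fun i _ => mul_self_nonneg _)
  have h1 : l * (r ⬝ᵥ r) ≤ l * (b ⬝ᵥ b + (n * l : ℝ)⁻¹ * (e ⬝ᵥ e)) := by
    have : l * ((n * l : ℝ)⁻¹ * (e ⬝ᵥ e)) = 1 / (n : ℝ) * (e ⬝ᵥ e) := by field_simp
    rw [mul_add, this]
    linarith
  exact le_of_mul_le_mul_left h1 hl

theorem dotProduct_sq_le {k : ℕ} (x y : Fin k → ℝ) : (x ⬝ᵥ y) ^ 2 ≤ (x ⬝ᵥ x) * (y ⬝ᵥ y) := by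
  simpa only [dotProduct, sq] using Finset.sum_mul_sq_le_sq_mul_sq Finset.univ x y

/-- A dominating function free of `X`, in which test and training variables separate as a product.
The `3` comes from squaring three terms; the `2` counts `b ⬝ᵥ b` once from `xt ⬝ᵥ b` and once from
the ridge bound. -/
theorem sqError_le (hn : 0 < n) {l : ℝ} (hl : 0 < l) (X : Matrix (Fin n) (Fin p) ℝ)
    (b : Fin p → ℝ) (e : Fin n → ℝ) (xt : Fin p → ℝ) (et : ℝ) :
    sqError l X b e xt et
      ≤ 3 * (et ^ 2 + (xt ⬝ᵥ xt) * (2 * (b ⬝ᵥ b) + (n * l : ℝ)⁻¹ * (e ⬝ᵥ e))) := by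
  have h1 := dotProduct_sq_le xt b
  have h2 := dotProduct_sq_le xt (ridge l X (response X b e))
  have h3 := mul_le_mul_of_nonneg_left (ridge_dotProduct_self_le hn hl X b e)
    (show 0 ≤ xt ⬝ᵥ xt from Finset.sum_nonneg fun i _ => mul_self_nonneg _)
  unfold sqError
  set x := xt ⬝ᵥ b
  set y := xt ⬝ᵥ ridge l X (response X b e)
  nlinarith [sq_nonneg (x - et), sq_nonneg (x + y), sq_nonneg (et + y)]

variable {β : Type*} [MeasurableSpace β]

theorem measurable_det {k : Type*} [Fintype k] [DecidableEq k] {M : β → Matrix k k ℝ}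
    (hM : ∀ i j, Measurable fun x => M x i j) : Measurable fun x => (M x).det := by
  simp only [Matrix.det_apply]
  exact Finset.measurable_sum _ fun τ _ =>
    (Finset.measurable_prod _ fun i _ => hM _ _).const_smul (Equiv.Perm.sign τ)

/-- The adjugate formula makes the entries rational in those of `M`; it also covers singular
matrices, whose inverse is `0` by convention. -/
theorem measurable_matrix_inv {k : Type*} [Fintype k] [DecidableEq k] {M : β → Matrix k k ℝ}
    (hM : ∀ i j, Measurable fun x => M x i j) (i j : k) : Measurable fun x => (M x)⁻¹ i j := by
  simp only [Matrix.inv_def, Matrix.smul_apply, Matrix.adjugate_apply, Ring.inverse_eq_inv',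
    smul_eq_mul]
  refine (measurable_det hM).inv.mul (measurable_det fun i' j' => ?_)
  simp only [Matrix.updateRow_apply]
  split_ifs
  · exact measurable_const
  · exact hM _ _

theorem measurable_dotProduct {k : Type*} [Fintype k] {v w : β → k → ℝ}
    (hv : ∀ j, Measurable fun x => v x j) (hw : ∀ j, Measurable fun x => w x j) :
    Measurable fun x => v x ⬝ᵥ w x :=
  Finset.measurable_sum _ fun j _ => (hv j).mul (hw j)

theorem measurable_sqError (l : ℝ) {X : β → Matrix (Fin n) (Fin p) ℝ} {b : β → Fin p → ℝ}
    {e : β → Fin n → ℝ} {xt : β → Fin p → ℝ} {et : β → ℝ}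
    (hX : ∀ i j, Measurable fun x => X x i j) (hb : Measurable b) (he : Measurable e)
    (hxt : Measurable xt) (het : Measurable et) :
    Measurable fun x => sqError l (X x) (b x) (e x) (xt x) (et x) := by
  have hQ : ∀ i j, Measurable fun x =>
      ((X x)ᵀ * X x + ((n : ℝ) * l) • (1 : Matrix (Fin p) (Fin p) ℝ))⁻¹ i j := by
    refine measurable_matrix_inv fun i j => ?_
    simp only [Matrix.add_apply, Matrix.mul_apply, Matrix.transpose_apply]
    exact (Finset.measurable_sum _ fun k _ => (hX k i).mul (hX k j)).add measurable_const
  have hv : ∀ {k : ℕ} {v : β → Fin k → ℝ}, Measurable v → ∀ j, Measurable fun x => v x j :=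
    fun h j => (measurable_pi_apply j).comp h
  have hY : ∀ i, Measurable fun x => response (X x) (b x) (e x) i := fun i =>
    (measurable_dotProduct (hX i) (hv hb)).add (hv he i)
  have hr : ∀ j, Measurable fun x => ridge l (X x) (response (X x) (b x) (e x)) j := fun j =>
    measurable_dotProduct (hQ j) fun i => measurable_dotProduct (fun m => hX m i) hY
  exact (((measurable_dotProduct (hv hxt) (hv hb)).add het).sub
    (measurable_dotProduct (hv hxt) hr)).pow_const 2

end Ridge

/-! ### Application to the probabilistic model -/

section Model

variable {Ω : Type*} [MeasurableSpace Ω] {P : Measure Ω} {n p : ℕ}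
  {α σ : ℝ} {U : Matrix (Fin n) (Fin p) ℝ} {g : Fin p → ℝ}
  {Z : Ω → Matrix (Fin n) (Fin p) ℝ} {e : Ω → Fin n → ℝ} {b : Ω → Fin p → ℝ}
  {z : Ω → Fin p → ℝ} {et : Ω → ℝ}

theorem testFeature_apply (g v : Fin p → ℝ) (j : Fin p) :
    testFeature g v j = √(g j ^ 2) * v j := by
  rw [testFeature, testCovSqrt, Matrix.mulVec_diagonal]

theorem IsModel.measurable_testFeature (hM : IsModel P U g α σ Z e b z et) :
    Measurable fun ω => testFeature g (z ω) := by
  have := hM.meas_z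
  refine measurable_pi_lambda _ fun j => ?_
  simp only [testFeature_apply]
  fun_prop

theorem IsModel.measurable_features (hM : IsModel P U g α σ Z e b z et) :
    Measurable fun ω => (fun i j => features U (Z ω) i j : Fin n → Fin p → ℝ) :=
  measurable_pi_lambda _ fun i => measurable_pi_lambda _ fun j => (hM.meas_Z i j).const_mul (U i j)

theorem IsModel.memLp_z (hM : IsModel P U g α σ Z e b z et) (j : Fin p) :
    MemLp (fun ω => z ω j) 2 P := by
  have hm : Measurable fun ω => z ω j := (measurable_pi_apply j).comp hM.meas_z
  refine (memLp_two_iff_integrable_sq hm.aestronglyMeasurable).2 ?_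
  -- A non-integrable square would have Bochner integral `0`, contradicting variance one.
  by_contra h
  have h1 := hM.var_z j
  rw [integral_undef h] at h1
  exact zero_ne_one h1

theorem IsModel.memLp_testFeature (hM : IsModel P U g α σ Z e b z et) (j : Fin p) :
    MemLp (fun ω => testFeature g (z ω) j) 2 P := by
  simp only [testFeature_apply]
  exact (hM.memLp_z j).const_mul _

theorem IsModel.indepFun_coeff_noise (hM : IsModel P U g α σ Z e b z et) : IndepFun b e P :=
  hM.indep_b.comp measurable_id (measurable_fst.comp measurable_snd)

theorem integrable_dotProduct_self {k : ℕ} {v : Ω → Fin k → ℝ}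
    (hv : ∀ j, MemLp (fun ω => v ω j) 2 P) : Integrable (fun ω => v ω ⬝ᵥ v ω) P := by
  simp only [dotProduct]
  exact integrable_finsetSum _ fun j _ => (hv j).integrable_fun_mul_two (hv j)

variable [IsProbabilityMeasure P]

theorem IsModel.indepFun_test_train (hM : IsModel P U g α σ Z e b z et) :
    IndepFun (fun ω => (testFeature g (z ω), et ω)) (fun ω => (b ω, e ω)) P := by
  have h1 : IndepFun b (fun ω => (e ω, (testFeature g (z ω), et ω))) P :=
    hM.indep_b.comp measurable_id measurable_snd
  have h2 : IndepFun e (fun ω => (testFeature g (z ω), et ω)) P :=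
    (hM.indep_test_train.comp measurable_id measurable_snd).symm
  exact (h1.assoc hM.meas_b hM.meas_e (hM.measurable_testFeature.prodMk hM.meas_et) h2).symm

/-- The form of independence needed to condition on the features: everything else, taken jointly, is
independent of them. -/
theorem IsModel.indepFun_features (hM : IsModel P U g α σ Z e b z et) :
    IndepFun (fun ω => (fun i j => features U (Z ω) i j : Fin n → Fin p → ℝ))
      (fun ω => (b ω, (testFeature g (z ω), et ω), e ω)) P := by
  have hT := hM.measurable_testFeature.prodMk hM.meas_et
  have hF := hM.measurable_features
  have h1 : IndepFun (fun ω => ((testFeature g (z ω), et ω), e ω))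
      (fun ω => (fun i j => features U (Z ω) i j : Fin n → Fin p → ℝ)) P :=
    IndepFun.assoc hT hM.meas_e hF
      (hM.indep_test_train.comp measurable_id measurable_swap) hM.indep_noise
  refine (IndepFun.assoc hM.meas_b (hT.prodMk hM.meas_e) hF ?_ h1).symm
  refine hM.indep_b.comp (ψ := fun q => ((q.2.2, q.2.1), q.1)) measurable_id ?_
  fun_prop

theorem IsModel.integrable_modelError (hM : IsModel P U g α σ Z e b z et) (hn : 0 < n)
    {l : ℝ} (hl : 0 < l) : Integrable (modelError U g Z e b z et l) P := by
  have hmeas : Measurable (modelError U g Z e b z et l) :=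
    measurable_sqError l (fun i j => (hM.meas_Z i j).const_mul (U i j)) hM.meas_b hM.meas_e
      hM.measurable_testFeature hM.meas_et
  have hind : IndepFun (fun ω => testFeature g (z ω) ⬝ᵥ testFeature g (z ω))
      (fun ω => 2 * (b ω ⬝ᵥ b ω) + (n * l : ℝ)⁻¹ * (e ω ⬝ᵥ e ω)) P := by
    refine hM.indepFun_test_train.comp (φ := fun q => q.1 ⬝ᵥ q.1)
      (ψ := fun q => 2 * (q.1 ⬝ᵥ q.1) + (n * l : ℝ)⁻¹ * (q.2 ⬝ᵥ q.2)) ?_ ?_ <;>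
    · simp only [dotProduct]
      fun_prop
  have hbd := (hM.sq_et.integrable_sq.add (hind.integrable_mul
    (integrable_dotProduct_self hM.memLp_testFeature)
    (((integrable_dotProduct_self hM.sq_b).const_mul 2).add
      ((integrable_dotProduct_self hM.sq_e).const_mul (n * l : ℝ)⁻¹)))).const_mul 3
  refine hbd.mono' hmeas.aestronglyMeasurable (ae_of_all _ fun ω => ?_)
  rw [Real.norm_of_nonneg (by exact sq_nonneg _)]
  exact sqError_le hn hl _ _ _ _ _

theorem IsModel.riskGiven_ae_eq_empRisk (hM : IsModel P U g α σ Z e b z et) (hn : 0 < n)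
    {l : ℝ} (hl : 0 < l) :
    (fun ω => riskGiven P g e b z et l (features U (Z ω))) =ᵐ[P] empRisk P U g Z e b z et l := by
  have hT := hM.measurable_testFeature.prodMk hM.meas_et
  let f : (Fin n → Fin p → ℝ) × ((Fin p → ℝ) × (((Fin p → ℝ) × ℝ) × (Fin n → ℝ))) → ℝ :=
    fun q => sqError l q.1 q.2.1 q.2.2.2 q.2.2.1.1 q.2.2.1.2
  have hf : Measurable f := by
    refine measurable_sqError l (fun i j => ?_) ?_ ?_ ?_ ?_
    · exact (measurable_pi_apply j).comp ((measurable_pi_apply i).comp measurable_fst)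
    all_goals fun_prop
  exact condExp_comap_ae_eq_integral_of_indepFun hM.measurable_features
    (hM.meas_b.prodMk (hT.prodMk hM.meas_e)) hM.indepFun_features hf
    (hM.integrable_modelError hn hl)

/-- The competing estimator may be any matrix acting on `Y`, so one comparison at fixed `A` serves
all `l` at once, with no exceptional null set. -/
theorem IsModel.riskGiven_optLambda_le (hM : IsModel P U g α σ Z e b z et) (hn : 0 < n)
    (hp : 0 < p) (hα : 0 < α) (hσ : 0 < σ) (l : ℝ) (A : Matrix (Fin n) (Fin p) ℝ) :
    riskGiven P g e b z et (optLambda n p α σ) A ≤ riskGiven P g e b z et l A := by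
  unfold riskGiven sqError
  simp only [ridge_eq_mulVec]
  exact integral_sq_error_le A hM.indepFun_test_train hM.indepFun_coeff_noise
    hM.memLp_testFeature hM.sq_et hM.sq_b hM.sq_e hM.mean_b hM.mean_e hM.cov_b hM.cov_e
    (ridge_optLambda_normal_eq hn hp hα hσ A) _

end Model

end RidgeVP

end

theorem mainTheorem4 {Ω : Type*} [MeasurableSpace Ω] (P : Measure Ω) [IsProbabilityMeasure P]
    (n p : ℕ) (hn : 0 < n) (hp : 0 < p) (α σ : ℝ) (hα : 0 < α) (hσ : 0 < σ)
    (U : Matrix (Fin n) (Fin p) ℝ) (g : Fin p → ℝ)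
    (Z : Ω → Matrix (Fin n) (Fin p) ℝ) (e : Ω → Fin n → ℝ) (b : Ω → Fin p → ℝ)
    (z : Ω → Fin p → ℝ) (et : Ω → ℝ)
    (hM : RidgeVP.IsModel P U g α σ Z e b z et) :
    -- the candidate is an admissible parameter
    0 < RidgeVP.optLambda n p α σ ∧
    -- the empirical risk is a genuine conditional expectation, and `riskGiven` is a version of it
    (∀ l : ℝ, 0 < l →
      Integrable (RidgeVP.modelError U g Z e b z et l) P ∧
      (fun ω => RidgeVP.riskGiven P g e b z et l (RidgeVP.features U (Z ω)))
        =ᵐ[P] RidgeVP.empRisk P U g Z e b z et l) ∧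
    -- minimality for the empirical risk, for each parameter almost surely
    (∀ l : ℝ, 0 < l →
      RidgeVP.empRisk P U g Z e b z et (RidgeVP.optLambda n p α σ)
        ≤ᵐ[P] RidgeVP.empRisk P U g Z e b z et l) ∧
    -- and pathwise, simultaneously for all parameters
    (∀ ω, ∀ l : ℝ, 0 < l →
      RidgeVP.riskGiven P g e b z et (RidgeVP.optLambda n p α σ) (RidgeVP.features U (Z ω))
        ≤ RidgeVP.riskGiven P g e b z et l (RidgeVP.features U (Z ω))) ∧
    -- the deterministic equivalent is well defined
    (∀ l : ℝ, 0 < l →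
      (∃! s, RidgeVP.IsDyson (RidgeVP.varProfile U) (-l) s) ∧
      ∀ j, DifferentiableAt ℝ (fun y => RidgeVP.dysonT (RidgeVP.varProfile U) y j) (-l)) ∧
    -- minimality for the deterministic equivalent
    (∀ l : ℝ, 0 < l →
      RidgeVP.detRisk U g α σ (RidgeVP.optLambda n p α σ) ≤ RidgeVP.detRisk U g α σ l) := by
  have hΓ : ∀ i j, 0 ≤ RidgeVP.varProfile U i j := fun i j => sq_nonneg (U i j)
  have ho := RidgeVP.optLambda_pos hn hp hα hσ
  refine ⟨ho, fun l hl => ⟨hM.integrable_modelError hn hl, hM.riskGiven_ae_eq_empRisk hn hl⟩,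
    fun l hl => ?_, fun ω l _ => hM.riskGiven_optLambda_le hn hp hα hσ l _,
    fun l hl => ⟨RidgeVP.existsUnique_isDyson hΓ hl, fun j =>
      (RidgeVP.hasDerivAt_dysonT hΓ hl j).differentiableAt⟩,
    fun l hl => RidgeVP.detRisk_optLambda_le hn hp hα hσ U g hl⟩
  -- The pointwise inequality passes to the conditional expectations through their versions at the
  -- two parameters.
  filter_upwards [hM.riskGiven_ae_eq_empRisk hn ho, hM.riskGiven_ae_eq_empRisk hn hl]
    with ω h1 h2
  rw [← h1, ← h2]
  exact hM.riskGiven_optLambda_le hn hp hα hσ l _
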